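/- Let $n\ge 2$, $k\ge 3$, $V=\mathbb{R}^n$ with coordinates $x_1,\dots,x_n$, and let $G=\mathrm{GL}(n,\mathbb{R})$ act on functions by $h\mapsto h\circ A^{-1}$ and on jets by prolongation. Let $\mathcal{E}$ be the Euler equation of homogeneous $k$-forms with all its prolongations: the set of jets $(x,u_\alpha)$ over $V\setminus 0$ with $$\sum_i x_iu_{\alpha+1_i}=(k-|\alpha|)u_\alpha\ \ (|\alpha|\le k-1),\qquad u_\beta=0\ \ (|\beta|\ge k+1).$$ It is irreducible; let $F$ be its field of rational functions (real coefficients, any finite order), with the total derivatives $\frac{d}{dx_i}$ ($x_j\mapsto\delta_{ij}$, $u_\alpha\mapsto u_{\alpha+1_i}$), and let $F^G\subset F$ be the set of $G$-invariant functions, the rational differential $G$-invariants of homogeneous $k$-forms. Horizontal vector fields are $\sum_iX_i\frac{d}{dx_i}$; they are identified with their components $(X_i)$. Let $\Theta_l=\sum_{|\alpha|=l}u_\alpha\frac{dx^\alpha}{\alpha!}$, regarded as a symmetric $l$-linear form on horizontal vectors (with $\Theta_l(X,\dots,X)=\sum_{|\alpha|=l}u_\alpha X^\alpha/\alpha!$),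 so that $\Theta_0=u$, and let $\Theta_l^0$ be its restriction to $\ker\Theta_1$. Where $u\ne0$ and $\Theta_2$ is nondegenerate, $\Theta_2^0$ is nondegenerate too; let $\lambda$ be the $1$-form on $\ker\Theta_1$ for which $\lambda(X)$ is the trace of $\Theta_3^0(X,\cdot,\cdot)$ with respect to $\Theta_2^0$, let $\widehat\lambda\in\ker\Theta_1$ be defined by $\Theta_2^0(\widehat\lambda,\cdot)=\lambda$, and the operator $\Phi$ on $\ker\Theta_1$ by $\Theta_3^0(\widehat\lambda,X,Y)=\Theta_2^0(\Phi X,Y)$. Put $$e_1=\widehat\lambda,\quad e_{i+1}=\Phi(e_i)\ (1\le i\le n-2),\quad e_n=\widehat\delta=\sum_ix_i\tfrac{d}{dx_i}.$$ A jet in $\mathcal{E}$ is regular if $u\neq0$, $\Theta_2$ is nondegenerate and $e_1,\dots,e_{n-1}$ are linearly independent; this depends on its 3-jet only. Then: 1. The regular jets are Zariski dense in $\mathcal{E}$. At each of them $e_1,\dots,e_n$ are a basis of the horizontal vectors. The regular domain is $G$-invariant and the frame is $G$-invariant: $e_a(A\theta)=A\,e_a(\theta)$ for every regular $\theta$ and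 $A\in G$. The frame depends on the 3-jet only, and its components are rational functions without poles on the regular domain. 2. $\Theta_0=u$ and the coefficients $\Theta_l^0(e_{a_1},\dots,e_{a_l})$, $2\le l\le k$, $1\le a_j\le n-1$, are $G$-invariant, are rational functions without poles on the regular domain, and generate over $\mathbb{R}$ the field of all rational differential $G$-invariants: $F^G$ is the subfield of $F$ that they generate over $\mathbb{R}$. 3. Let $J_1,\dots,J_n=\Theta_0\in F^G$ be in general position, i.e. $\widehat dJ_1\wedge\dots\wedge\widehat dJ_n\ne0$ in $F$, where $\widehat df=\sum_i\frac{df}{dx_i}dx_i$. Put $U=(J_{ab})$ with $J_{ab}=e_a(J_b)$, and $\Gamma=(\Gamma_{ab}^c)$ with $\widehat\nabla_{e_a}(e_b)=\sum_c\Gamma_{ab}^ce_c$, where $\widehat\nabla$ is the total lift of the standard flat connection on $V$. The Tresse derivatives $\frac{df}{dJ_b}$ of $f\in F$ are defined by $\widehat df=\sum_b\frac{df}{dJ_b}\widehat dJ_b$. Then $F^G$ is the subfield of $F$ generated over $\mathbb{R}$ by $J$ and the iterated Tresse derivatives, of all orders $0,1,2,\dots$, of the functions $J_{ab}$ and $\Gamma_{ab}^c$.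 -/

import Mathlib

open MvPolynomial

noncomputable section

namespace HomForms

/-! ### Jets and the Euler equation -/

/-- Coordinates on the infinite jet space of functions on an `n`-dimensional vector space:
`Sum.inl i` is the base coordinate `x_i`, and `Sum.inr α` is the jet coordinate `u_α`. -/
abbrev Coord (n : ℕ) : Type := Fin n ⊕ (Fin n →₀ ℕ)

/-- Infinite jets of functions, in the canonical coordinates `(x_i, u_α)`. -/
abbrev Jet (K : Type*) (n : ℕ) : Type _ := Coord n → K

/-- The multi-index `1_i`. -/
abbrev oneAt {n : ℕ} (i : Fin n) : Fin n →₀ ℕ := Finsupp.single i 1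

/-- The Euler equation for `k`-forms with all of its prolongations (a subset of the infinite jet
space over `V ∖ 0`):
`∑ x_i u_{α+1_i} = (k - |α|) u_α` for `|α| ≤ k - 1`, and `u_β = 0` for `|β| ≥ k + 1`. -/
def eulerEq (n k : ℕ) : Set (Jet ℝ n) :=
  {θ | (∃ i, θ (Sum.inl i) ≠ 0) ∧
    (∀ α : Fin n →₀ ℕ, α.degree < k →
      ∑ i, θ (Sum.inl i) * θ (Sum.inr (α + oneAt i)) = ((k : ℝ) - α.degree) * θ (Sum.inr α)) ∧
    ∀ β : Fin n →₀ ℕ, k < β.degree → θ (Sum.inr β) = 0}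

/-- Polynomial functions of finite order on the jet spaces. -/
abbrev JetPoly (n : ℕ) : Type := MvPolynomial (Coord n) ℝ

/-- The ideal of the polynomial functions that vanish on the Euler equation. -/
def eulerIdeal (n k : ℕ) : Ideal (JetPoly n) := vanishingIdeal ℝ (eulerEq n k)

/-- Values on the coordinates of the total derivative `d/dx_i`:
`x_j ↦ δ_ij`, `u_α ↦ u_{α+1_i}`. -/
def totalDerivCoord {n : ℕ} (i : Fin n) : Coord n → JetPoly n
  | Sum.inl j => if j = i then 1 else 0
  | Sum.inr α => X (Sum.inr (α + oneAt i))

/-- The total derivative `d/dx_i` on the polynomial functions on jets. -/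
def totalDerivPoly {n : ℕ} (i : Fin n) : Derivation ℝ (JetPoly n) (JetPoly n) :=
  mkDerivation ℝ (totalDerivCoord i)

/-! ### Irreducibility of the Euler equation, and total derivatives along it -/

namespace Aux

variable {n : ℕ}

def wt (γ : Fin n →₀ ℕ) : ℝ := (∏ i, ((γ i).factorial : ℝ))⁻¹

def xpow (γ : Fin n →₀ ℕ) : JetPoly n := ∏ i, X (Sum.inl i) ^ γ i

/-- The Taylor polynomial of degree `m` of `u_β` in the base coordinates. -/
def tay (β : Fin n →₀ ℕ) (m : ℕ) : JetPoly n :=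
  ∑ γ ∈ Finset.finsuppAntidiag Finset.univ m, C (wt γ) * (X (Sum.inr (β + γ)) * xpow γ)

def retr (n k : ℕ) : JetPoly n →ₐ[ℝ] JetPoly n :=
  aeval (Sum.elim (fun i => X (Sum.inl i))
    (fun β => if β.degree ≤ k then tay β (k - β.degree) else 0))

lemma mem_anti {γ : Fin n →₀ ℕ} {m : ℕ} :
    γ ∈ Finset.finsuppAntidiag (Finset.univ : Finset (Fin n)) m ↔ γ.degree = m := by
  simp [Finset.mem_finsuppAntidiag, Finsupp.degree_eq_sum]

lemma sum_shift (i : Fin n) (m : ℕ) (g : (Fin n →₀ ℕ) → JetPoly n) :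
    ∑ γ ∈ Finset.finsuppAntidiag Finset.univ (m + 1), (γ i : JetPoly n) * g γ =
      ∑ γ ∈ Finset.finsuppAntidiag Finset.univ m, ((γ i : JetPoly n) + 1) * g (γ + oneAt i) := by
  symm
  refine Finset.sum_of_injOn (fun γ => γ + oneAt i) ?_ ?_ ?_ ?_
  · intro a _ b _ h
    exact add_right_cancel h
  · intro a ha
    simp only [Finset.mem_coe, mem_anti] at ha ⊢
    simp [map_add, ha]
  · intro γ hγ hn
    have h0 : γ i = 0 := by
      by_contra h
      apply hn
      have hle : oneAt i ≤ γ := by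
        simpa [Finsupp.single_le_iff] using Nat.one_le_iff_ne_zero.mpr h
      refine ⟨γ - oneAt i, ?_, tsub_add_cancel_of_le hle⟩
      have := congrArg Finsupp.degree (tsub_add_cancel_of_le hle)
      rw [map_add] at this
      simp only [Finset.mem_coe, mem_anti] at hγ ⊢
      simp at this
      omega
    simp [h0]
  · intro a _
    simp

lemma wt_shift (γ : Fin n →₀ ℕ) (i : Fin n) :
    ((γ i : ℝ) + 1) * wt (γ + oneAt i) = wt γ := by
  have h : (∏ j, (((γ + oneAt i) j).factorial : ℝ)) =
      ((γ i : ℝ) + 1) * ∏ j, ((γ j).factorial : ℝ) := by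
    rw [← Finset.mul_prod_erase _ _ (Finset.mem_univ i),
      ← Finset.mul_prod_erase _ (fun j => ((γ j).factorial : ℝ)) (Finset.mem_univ i), ← mul_assoc]
    congr 1
    · simp [Nat.factorial_succ]
    · refine Finset.prod_congr rfl fun j hj => ?_
      have : i ≠ j := (Finset.ne_of_mem_erase hj).symm
      simp [this]
  unfold wt
  rw [h, mul_inv, ← mul_assoc, mul_inv_cancel₀ (by positivity), one_mul]

lemma xpow_shift (γ : Fin n →₀ ℕ) (i : Fin n) :
    xpow (γ + oneAt i) = X (Sum.inl i) * xpow γ := by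
  unfold xpow
  simp only [Finsupp.add_apply, pow_add, Finset.prod_mul_distrib]
  rw [mul_comm]
  congr 1
  rw [Finset.prod_eq_single i] <;> simp +contextual [eq_comm]

lemma C_wt_shift (γ : Fin n →₀ ℕ) (i : Fin n) :
    ((γ i : JetPoly n) + 1) * C (wt (γ + oneAt i)) = C (wt γ) := by
  rw [← wt_shift γ i]
  simp

lemma tay_euler (β : Fin n →₀ ℕ) (m : ℕ) :
    ∑ i, X (Sum.inl i) * tay (β + oneAt i) m = ((m : JetPoly n) + 1) * tay β (m + 1) := by
  have h : ((m : JetPoly n) + 1) * tay β (m + 1) =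
      ∑ i, ∑ γ ∈ Finset.finsuppAntidiag Finset.univ (m + 1),
        (γ i : JetPoly n) * (C (wt γ) * (X (Sum.inr (β + γ)) * xpow γ)) := by
    rw [Finset.sum_comm, tay, Finset.mul_sum]
    refine Finset.sum_congr rfl fun γ hγ => ?_
    rw [← Finset.sum_mul]
    congr 1
    rw [mem_anti, Finsupp.degree_eq_sum] at hγ
    rw [← Nat.cast_sum, hγ]
    simp
  rw [h]
  refine Finset.sum_congr rfl fun i _ => ?_
  rw [sum_shift i m, tay, Finset.mul_sum]
  refine Finset.sum_congr rfl fun γ _ => ?_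
  rw [← C_wt_shift γ i, xpow_shift, add_assoc β, add_comm (oneAt i) γ]
  ring

lemma pderiv_xpow (γ : Fin n →₀ ℕ) (i : Fin n) :
    pderiv (Sum.inl i) (xpow γ) = (γ i : JetPoly n) * xpow (γ - oneAt i) := by
  have hz : ∀ s : Finset (Fin n), i ∉ s →
      pderiv (Sum.inl i) (∏ j ∈ s, (X (Sum.inl j) : JetPoly n) ^ γ j) = 0 := by
    intro s
    induction s using Finset.induction_on with
    | empty => intro _; simp
    | insert a s ha ih =>
      intro hi
      rw [Finset.mem_insert, not_or] at hi
      rw [Finset.prod_insert ha, Derivation.leibniz, ih hi.2, Derivation.leibniz_pow,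
        pderiv_X_of_ne (by simpa using Ne.symm hi.1)]
      simp
  have he : ∏ j ∈ Finset.univ.erase i, (X (Sum.inl j) : JetPoly n) ^ (γ - oneAt i) j =
      ∏ j ∈ Finset.univ.erase i, X (Sum.inl j) ^ γ j := by
    refine Finset.prod_congr rfl fun j hj => ?_
    have : i ≠ j := (Finset.ne_of_mem_erase hj).symm
    simp [this]
  unfold xpow
  rw [← Finset.mul_prod_erase _ (fun j => (X (Sum.inl j) : JetPoly n) ^ γ j) (Finset.mem_univ i),
    ← Finset.mul_prod_erase _ (fun j => (X (Sum.inl j) : JetPoly n) ^ (γ - oneAt i) j)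
      (Finset.mem_univ i), he, Derivation.leibniz, hz _ (Finset.notMem_erase i _),
    Derivation.leibniz_pow, pderiv_X_self]
  simp
  ring

lemma pderiv_tay (β : Fin n →₀ ℕ) (m : ℕ) (i : Fin n) :
    pderiv (Sum.inl i) (tay β (m + 1)) = tay (β + oneAt i) m := by
  unfold tay
  rw [map_sum]
  have h : ∀ γ : Fin n →₀ ℕ,
      pderiv (Sum.inl i) (C (wt γ) * (X (Sum.inr (β + γ)) * xpow γ) : JetPoly n) =
        (γ i : JetPoly n) * (C (wt γ) * (X (Sum.inr (β + γ)) * xpow (γ - oneAt i))) := by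
    intro γ
    rw [pderiv_C_mul, Derivation.leibniz, pderiv_xpow, pderiv_X_of_ne (by simp)]
    simp
    ring
  rw [Finset.sum_congr rfl fun γ _ => h γ,
    sum_shift i m fun γ => C (wt γ) * (X (Sum.inr (β + γ)) * xpow (γ - oneAt i))]
  refine Finset.sum_congr rfl fun γ _ => ?_
  rw [← C_wt_shift γ i, add_tsub_cancel_right, add_assoc β, add_comm (oneAt i) γ]
  ring

lemma tay_zero (β : Fin n →₀ ℕ) : tay β 0 = X (Sum.inr β) := by
  simp [tay, wt, xpow]

lemma retr_totalDeriv (k : ℕ) (i : Fin n) (P : JetPoly n) :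
    retr n k (totalDerivPoly i P) = pderiv (Sum.inl i) (retr n k P) := by
  induction P using MvPolynomial.induction_on with
  | C a => simp [totalDerivPoly, retr]
  | add p q hp hq => simp [hp, hq]
  | mul_X p v hp =>
    rw [Derivation.leibniz, map_mul, Derivation.leibniz, map_add, smul_eq_mul, smul_eq_mul,
      map_mul, map_mul, hp, smul_eq_mul, smul_eq_mul]
    congr 2
    rw [totalDerivPoly, mkDerivation_X]
    rcases v with j | β
    · simp only [totalDerivCoord, retr, aeval_X, Sum.elim_inl]
      by_cases h : j = i
      · subst h; simp
      · rw [pderiv_X_of_ne (by simpa using h)]; simp [h]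
    · simp only [totalDerivCoord, retr, aeval_X, Sum.elim_inr]
      have hd : (β + oneAt i).degree = β.degree + 1 := by simp
      rw [hd]
      rcases lt_trichotomy β.degree k with h | h | h
      · obtain ⟨m, hm⟩ : ∃ m, k = β.degree + (m + 1) := ⟨k - β.degree - 1, by omega⟩
        rw [if_pos (by omega), if_pos h.le, show k - β.degree = m + 1 by omega,
          show k - (β.degree + 1) = m by omega, pderiv_tay]
      · rw [if_neg (by omega), if_pos h.le, h, Nat.sub_self, tay_zero, pderiv_X_of_ne (by simp)]
      · rw [if_neg (by omega), if_neg (by omega), map_zero]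

def retrPt (k : ℕ) (θ : Jet ℝ n) : Jet ℝ n := fun v => eval θ (retr n k (X v))

lemma eval_retr (k : ℕ) (θ : Jet ℝ n) (P : JetPoly n) :
    eval θ (retr n k P) = eval (retrPt k θ) P := by
  induction P using MvPolynomial.induction_on with
  | C a => simp [retr]
  | add p q hp hq => simp [hp, hq]
  | mul_X p v hp => rw [map_mul, map_mul, map_mul, hp, eval_X]; rfl

lemma retrPt_inl (k : ℕ) (θ : Jet ℝ n) (i : Fin n) :
    retrPt k θ (Sum.inl i) = θ (Sum.inl i) := by
  simp [retrPt, retr]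

lemma retrPt_inr (k : ℕ) (θ : Jet ℝ n) (β : Fin n →₀ ℕ) :
    retrPt k θ (Sum.inr β) = if β.degree ≤ k then eval θ (tay β (k - β.degree)) else 0 := by
  simp only [retrPt, retr, aeval_X, Sum.elim_inr]
  split_ifs <;> simp

lemma retrPt_mem (k : ℕ) (θ : Jet ℝ n) (h : ∃ i, θ (Sum.inl i) ≠ 0) :
    retrPt k θ ∈ eulerEq n k := by
  refine ⟨by simpa [retrPt_inl] using h, fun α hα => ?_, fun β hβ => ?_⟩
  · obtain ⟨m, hm⟩ : ∃ m, k = α.degree + (m + 1) := ⟨k - α.degree - 1, by omega⟩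
    have hd : ∀ i, (α + oneAt i).degree = α.degree + 1 := fun i => by simp
    have := congrArg (eval θ) (tay_euler α m)
    simp only [retrPt_inl, retrPt_inr, hd]
    rw [if_pos hα.le, show k - α.degree = m + 1 by omega,
      show k - (α.degree + 1) = m by omega]
    simp only [show α.degree + 1 ≤ k by omega, if_true]
    simp only [map_sum, map_mul, eval_X, map_add, map_natCast, map_one] at this
    rw [this, hm]
    push_cast
    ring
  · rw [retrPt_inr, if_neg (by omega)]

lemma retrPt_eq (k : ℕ) (θ : Jet ℝ n) (h : θ ∈ eulerEq n k) : retrPt k θ = θ := by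
  have key : ∀ m (β : Fin n →₀ ℕ), β.degree + m = k → eval θ (tay β m) = θ (Sum.inr β) := by
    intro m
    induction m with
    | zero => intro β _; simp [tay_zero]
    | succ m ih =>
      intro β hβ
      have h1 := congrArg (eval θ) (tay_euler β m)
      simp only [map_sum, map_mul, eval_X, map_add, map_natCast, map_one] at h1
      have h2 := h.2.1 β (by omega)
      rw [Finset.sum_congr rfl fun i _ => by rw [ih (β + oneAt i) (by simp; omega)], h2, ← hβ] at h1
      push_cast at h1
      have h3 : ((m : ℝ) + 1) ≠ 0 := by positivity
      apply mul_left_cancel₀ h3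
      rw [← h1]
      ring
  funext v
  rcases v with i | β
  · exact retrPt_inl k θ i
  · rw [retrPt_inr]
    split_ifs with hβ
    · exact key _ β (by omega)
    · exact (h.2.2 β (by omega)).symm

lemma mem_eulerIdeal_iff {k : ℕ} {P : JetPoly n} :
    P ∈ eulerIdeal n k ↔ ∀ θ ∈ eulerEq n k, eval θ P = 0 := by
  simp [eulerIdeal, mem_vanishingIdeal_iff, aeval_eq_eval]

lemma mem_eulerIdeal_iff_retr [NeZero n] {k : ℕ} {P : JetPoly n} :
    P ∈ eulerIdeal n k ↔ retr n k P = 0 := by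
  rw [mem_eulerIdeal_iff]
  constructor
  · intro h
    have : (X (Sum.inl 0) : JetPoly n) * retr n k P = 0 := by
      apply MvPolynomial.funext
      intro θ
      by_cases h0 : θ (Sum.inl 0) = 0
      · simp [h0]
      · rw [map_mul, eval_retr, h _ (retrPt_mem k θ ⟨0, h0⟩)]
        simp
    rcases mul_eq_zero.mp this with h1 | h1
    · exact absurd h1 (X_ne_zero _)
    · exact h1
  · intro h θ hθ
    have := eval_retr k θ P
    rw [h, retrPt_eq k θ hθ] at this
    simpa using this.symm

end Aux

/-- The Euler equation is irreducible. -/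
instance eulerIdeal_isPrime (n k : ℕ) [NeZero n] : (eulerIdeal n k).IsPrime := by
  have : eulerIdeal n k = RingHom.ker (Aux.retr n k) := by
    ext P
    rw [Aux.mem_eulerIdeal_iff_retr, RingHom.mem_ker]
  rw [this]
  exact RingHom.ker_isPrime _

/-- The total derivatives are tangent to the Euler equation. -/
theorem totalDerivPoly_mem {n k : ℕ} [NeZero n] (i : Fin n) {P : JetPoly n}
    (h : P ∈ eulerIdeal n k) : totalDerivPoly i P ∈ eulerIdeal n k := by
  rw [Aux.mem_eulerIdeal_iff_retr] at h ⊢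
  rw [Aux.retr_totalDeriv, h, map_zero]

/-- The field of rational functions (of arbitrary finite order) on the Euler equation. -/
abbrev RatFun (n k : ℕ) [NeZero n] : Type := FractionRing (JetPoly n ⧸ eulerIdeal n k)

/-- The restriction of a polynomial function on jets to the Euler equation. -/
def toRat (n k : ℕ) [NeZero n] : JetPoly n →ₐ[ℝ] RatFun n k :=
  (IsScalarTower.toAlgHom ℝ (JetPoly n ⧸ eulerIdeal n k) (RatFun n k)).comp
    (Ideal.Quotient.mkₐ ℝ (eulerIdeal n k))

namespace Aux

section Extension

variable {R A F : Type*} [CommRing R] [Algebra ℝ R] [CommRing A] [Algebra ℝ A] [Field F]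
  [Algebra ℝ F] [Algebra A F] [IsScalarTower ℝ A F]

/-- `P ↦ g P + ε g (D P)`, with values in the dual numbers. -/
def dualHom (g : R →ₐ[ℝ] A) (D : Derivation ℝ R R) : R →ₐ[ℝ] DualNumber A where
  toFun P := TrivSqZeroExt.inl (g P) + TrivSqZeroExt.inr (g (D P))
  map_one' := by ext <;> simp
  map_zero' := by ext <;> simp
  map_mul' P Q := by
    ext
    · simp
    · simp only [TrivSqZeroExt.snd_add, TrivSqZeroExt.snd_inl, TrivSqZeroExt.snd_inr,
        TrivSqZeroExt.snd_mul, TrivSqZeroExt.fst_add, TrivSqZeroExt.fst_inl,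
        TrivSqZeroExt.fst_inr, Derivation.leibniz, map_add, map_mul, smul_eq_mul,
        MulOpposite.smul_eq_mul_unop, MulOpposite.unop_op]
      ring
  map_add' P Q := by ext <;> simp
  commutes' r := by ext <;> simp [TrivSqZeroExt.algebraMap_eq_inl']

lemma fst_dualHom (g : R →ₐ[ℝ] A) (D : Derivation ℝ R R) (P : R) :
    (dualHom g D P).fst = g P := by
  simp [dualHom]

lemma snd_dualHom (g : R →ₐ[ℝ] A) (D : Derivation ℝ R R) (P : R) :
    (dualHom g D P).snd = g (D P) := by
  simp [dualHom]

/-- The derivation defined by a section of the projection from the dual numbers. -/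
def sndDeriv (φ : A →ₐ[ℝ] DualNumber A) (h : ∀ a, (φ a).fst = a) : Derivation ℝ A A :=
  Derivation.mk'
    { toFun := fun a => (φ a).snd
      map_add' := by intros; simp
      map_smul' := by intros; simp }
    (by
      intro a b
      simp [h, mul_comm])

/-- The derivation induced on a quotient. -/
def quotDeriv (I : Ideal R) (D : Derivation ℝ R R) (h : ∀ P ∈ I, D P ∈ I) :
    Derivation ℝ (R ⧸ I) (R ⧸ I) :=
  sndDeriv
    (Ideal.Quotient.liftₐ I (dualHom (Ideal.Quotient.mkₐ ℝ I) D) (by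
      intro P hP
      ext
      · rw [fst_dualHom]; exact Ideal.Quotient.eq_zero_iff_mem.mpr hP
      · rw [snd_dualHom]; exact Ideal.Quotient.eq_zero_iff_mem.mpr (h P hP)))
    (by
      intro p
      obtain ⟨P, rfl⟩ := Ideal.Quotient.mk_surjective p
      exact fst_dualHom _ _ P)

lemma quotDeriv_mk (I : Ideal R) (D : Derivation ℝ R R) (h : ∀ P ∈ I, D P ∈ I) (P : R) :
    quotDeriv I D h (Ideal.Quotient.mk I P) = Ideal.Quotient.mk I (D P) :=
  snd_dualHom _ _ P

variable (F) in
/-- `a ↦ a + ε D a`, with values in the dual numbers over the fraction field. -/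
def fracDual (D : Derivation ℝ A A) : A →ₐ[ℝ] DualNumber F :=
  dualHom (IsScalarTower.toAlgHom ℝ A F) D

lemma fst_fracDual (D : Derivation ℝ A A) (a : A) :
    (fracDual F D a).fst = algebraMap A F a :=
  fst_dualHom _ _ a

lemma isUnit_fracDual [IsFractionRing A F] (D : Derivation ℝ A A) (y : nonZeroDivisors A) :
    IsUnit (fracDual F D y) := by
  rw [TrivSqZeroExt.isUnit_iff_isUnit_fst, fst_fracDual]
  exact IsLocalization.map_units F y

/-- The derivation induced on a fraction field. -/
def fracDeriv (F : Type*) [Field F] [Algebra ℝ F] [Algebra A F] [IsScalarTower ℝ A F]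
    [IsFractionRing A F] (D : Derivation ℝ A A) : Derivation ℝ F F :=
  sndDeriv
    (IsLocalization.liftAlgHom (M := nonZeroDivisors A) (f := fracDual F D) (isUnit_fracDual D))
    (by
      have h : (TrivSqZeroExt.fstHom ℝ F F).toRingHom.comp (IsLocalization.liftAlgHom
          (M := nonZeroDivisors A) (S := F) (f := fracDual F D)
            (isUnit_fracDual D)).toRingHom = RingHom.id F := by
        apply IsLocalization.ringHom_ext (nonZeroDivisors A)
        ext a
        have := IsLocalization.lift_eq (M := nonZeroDivisors A) (S := F)
          (g := (fracDual F D).toRingHom) (isUnit_fracDual D) a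
        exact (congrArg TrivSqZeroExt.fst this).trans (fst_fracDual D a)
      exact fun f => congrArg (fun φ => φ f) h)

lemma fracDeriv_algebraMap [IsFractionRing A F] (D : Derivation ℝ A A) (a : A) :
    fracDeriv F D (algebraMap A F a) = algebraMap A F (D a) := by
  have := IsLocalization.lift_eq (M := nonZeroDivisors A) (S := F)
    (g := (fracDual F D).toRingHom) (isUnit_fracDual D) a
  exact (congrArg TrivSqZeroExt.snd this).trans (snd_dualHom _ _ a)

end Extension

end Aux

/-- The total derivative `d/dx_i` on the rational functions on the Euler equation. -/
def totalDeriv {n k : ℕ} [NeZero n] (i : Fin n) : Derivation ℝ (RatFun n k) (RatFun n k) :=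
  Aux.fracDeriv (RatFun n k)
    (Aux.quotDeriv (eulerIdeal n k) (totalDerivPoly i) fun _ hP => totalDerivPoly_mem i hP)

/-- `totalDeriv` extends the total derivative of polynomial functions (hence, being a derivation,
it is given by the quotient rule). -/
theorem totalDeriv_toRat {n k : ℕ} [NeZero n] (i : Fin n) (P : JetPoly n) :
    totalDeriv i (toRat n k P) = toRat n k (totalDerivPoly i P) :=
  (Aux.fracDeriv_algebraMap _ _).trans (congrArg _ (Aux.quotDeriv_mk _ _ _ P))

/-! ### Universal tensors and the frame

A horizontal vector `∑ X_i d/dx_i` at a jet is given by its components `X : Fin n → K`. The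
constructions are made over an arbitrary field `K`: with `K = ℝ` they are the constructions at
a point of the jet space; applied to the tautological jet over the field of rational functions they
give the corresponding rational objects. -/

section Tensors

variable {K : Type*} [Field K] {n : ℕ}

/-- The value at the jet `θ` of a differential operator with constant coefficients:
`∑ c_α ∂^α ↦ ∑ c_α u_α`. -/
def applyOp (θ : Jet K n) : MvPolynomial (Fin n) K →ₗ[K] K :=
  (basisMonomials (Fin n) K).constr K fun α => θ (Sum.inr α)

/-- The (symbol of the) directional derivative `∑ X_i ∂_i`. -/
def dirOp : (Fin n → K) →ₗ[K] MvPolynomial (Fin n) K :=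
  Fintype.linearCombination K fun i => (X i : MvPolynomial (Fin n) K)

/-- The universal symmetric tensor `Θ_l = ∑_{|α| = l} u_α dx^α / α!` as a symmetric `l`-linear form
on horizontal vectors, `Θ_l(X₁, …, X_l) = (1 / l!) X₁ ⋯ X_l u`; on the diagonal it is
`Θ_l(X, …, X) = ∑_{|α| = l} u_α X^α / α!`. -/
def theta (θ : Jet K n) (l : ℕ) (Y : Fin l → Fin n → K) : K :=
  (l.factorial : K)⁻¹ * applyOp θ (∏ j, dirOp (Y j))

/-- `ker Θ₁`. -/
def kerTheta1 (θ : Jet K n) : Submodule K (Fin n → K) :=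
  LinearMap.ker (applyOp θ ∘ₗ dirOp)

/-- `Θ₂` as a bilinear form on horizontal vectors. -/
def theta2 (θ : Jet K n) : LinearMap.BilinForm K (Fin n → K) :=
  LinearMap.mk₂ K (fun Y Z => theta θ 2 ![Y, Z])
    (by intros; simp [theta, Fin.prod_univ_two, add_mul, mul_add])
    (by intros; simp [theta, Fin.prod_univ_two, mul_left_comm])
    (by intros; simp [theta, Fin.prod_univ_two, mul_add])
    (by intros; simp [theta, Fin.prod_univ_two, mul_left_comm])

/-- `Θ₂⁰`, the restriction of `Θ₂` to `ker Θ₁`. -/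
def theta20 (θ : Jet K n) : LinearMap.BilinForm K (kerTheta1 θ) :=
  (theta2 θ).restrict (kerTheta1 θ)

/-- `Θ₃⁰`, the restriction of `Θ₃` to `ker Θ₁`, as `X ↦ Y ↦ Θ₃⁰(X, Y, ·)`. -/
def theta30 (θ : Jet K n) :
    kerTheta1 θ →ₗ[K] kerTheta1 θ →ₗ[K] Module.Dual K (kerTheta1 θ) :=
  LinearMap.mk₂ K
    (fun W Y =>
      { toFun := fun Z => theta θ 3 ![(W : Fin n → K), (Y : Fin n → K), (Z : Fin n → K)]
        map_add' := by intros; simp [theta, Fin.prod_univ_three, mul_add]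
        map_smul' := by intros; simp [theta, Fin.prod_univ_three, mul_left_comm] })
    (by intros; ext; simp [theta, Fin.prod_univ_three, mul_add, add_mul])
    (by intros; ext; simp [theta, Fin.prod_univ_three, mul_left_comm])
    (by intros; ext; simp [theta, Fin.prod_univ_three, mul_add, add_mul])
    (by intros; ext; simp [theta, Fin.prod_univ_three, mul_left_comm])

open Classical in
/-- The inverse tensor of `Θ₂⁰`, as a map from 1-forms to vectors: `sharp θ φ` is the vector of
`ker Θ₁` with `Θ₂⁰(sharp θ φ, ·) = φ` (`Θ₂⁰` is nondegenerate at the jets of the Euler equation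
where `u ≠ 0` and `Θ₂` is nondegenerate; elsewhere the value is irrelevant). -/
def sharp (θ : Jet K n) : Module.Dual K (kerTheta1 θ) →ₗ[K] kerTheta1 θ :=
  if h : (theta20 θ).Nondegenerate then ((theta20 θ).toDual h).symm.toLinearMap else 0

/-- For `W` in `ker Θ₁`, the operator `S` on `ker Θ₁` with `Θ₃⁰(W, Y, Z) = Θ₂⁰(S Y, Z)`. -/
def cubicOp (θ : Jet K n) : kerTheta1 θ →ₗ[K] Module.End K (kerTheta1 θ) :=
  LinearMap.compRight K (sharp θ) ∘ₗ theta30 θ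

/-- The 1-form `λ` on `ker Θ₁`: the contraction of `Θ₃⁰` with the inverse tensor of `Θ₂⁰`, that is,
`λ(W)` is the trace of the bilinear form `Θ₃⁰(W, ·, ·)` with respect to `Θ₂⁰`. -/
def lam (θ : Jet K n) : Module.Dual K (kerTheta1 θ) :=
  LinearMap.trace K (kerTheta1 θ) ∘ₗ cubicOp θ

/-- The vector dual to `λ` with respect to `Θ₂⁰`. -/
def lamHat (θ : Jet K n) : kerTheta1 θ := sharp θ (lam θ)

/-- The operator `Φ` on `ker Θ₁` with `Θ₃⁰(λ̂, Y, Z) = Θ₂⁰(Φ Y, Z)`. -/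
def Phi (θ : Jet K n) : Module.End K (kerTheta1 θ) := cubicOp θ (lamHat θ)

/-- `λ̂, Φ λ̂, Φ² λ̂, …`, numbered from `0`. -/
def kerFrame (θ : Jet K n) (a : ℕ) : kerTheta1 θ := (Phi θ ^ a) (lamHat θ)

/-- The vectors `e_1, …, e_{n-1}` (the first `n - 1` of `λ̂, Φ λ̂, …`), and `e_n = δ̂`, the radial
field `∑ x_i d/dx_i`; numbered from `0`. -/
def frame (θ : Jet K n) (a : Fin n) : Fin n → K :=
  if a.val + 1 < n then (kerFrame θ a.val : Fin n → K) else fun i => θ (Sum.inl i)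

/-- Regular jets: `u ≠ 0`, the form `Θ₂` is nondegenerate, and `e_1, …, e_{n-1}` are linearly
independent. -/
def IsRegularJet (θ : Jet K n) : Prop :=
  θ (Sum.inr 0) ≠ 0 ∧ (theta2 θ).Nondegenerate ∧
    LinearIndependent K fun a : Fin (n - 1) => kerFrame θ a.val

/-- The coefficient `Θ_l⁰(e_{a_1}, …, e_{a_l})` of the restriction `Θ_l⁰` of `Θ_l` to `ker Θ₁` in the
frame `e_1, …, e_{n-1}` of `ker Θ₁`. -/
def thetaCoeff (θ : Jet K n) (l : ℕ) (a : Fin l → Fin (n - 1)) : K :=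
  theta θ l fun j => (kerFrame θ (a j).val : Fin n → K)

end Tensors

/-- The regular domain in the Euler equation (jets whose 3-jet is regular). -/
def regularDomain (n k : ℕ) : Set (Jet ℝ n) := {θ | θ ∈ eulerEq n k ∧ IsRegularJet θ}

/-! ### The action of the general linear group and its invariants -/

/-- The prolonged action on jets. It sends the jet of `h` at `x` to the jet of `h ∘ A⁻¹` at `A x`;
by the chain rule `∂_i` of the latter is `∑_j (A⁻¹)_{ji} ∂_j` of the former. -/
def act {n : ℕ} (A : GL (Fin n) ℝ) (θ : Jet ℝ n) : Jet ℝ n :=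
  Sum.elim ((A : Matrix (Fin n) (Fin n) ℝ).mulVec fun i => θ (Sum.inl i))
    (fun α => applyOp θ
      (∏ i, dirOp (fun j => ((A⁻¹ : GL (Fin n) ℝ) : Matrix (Fin n) (Fin n) ℝ) j i) ^ α i))

section Invariants

variable {n k : ℕ} [NeZero n]

/-- The rational function `f` on the Euler equation is defined at `θ`, with the value `c`. -/
def HasValue (f : RatFun n k) (θ : Jet ℝ n) (c : ℝ) : Prop :=
  ∃ P Q : JetPoly n, eval θ Q ≠ 0 ∧ f * toRat n k Q = toRat n k P ∧ c = eval θ P / eval θ Q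

/-- Rational differential invariants: rational functions (of any finite order) on the Euler
equation that are preserved by the prolonged action. -/
def IsInvariant (f : RatFun n k) : Prop :=
  ∀ (A : GL (Fin n) ℝ), ∀ θ ∈ eulerEq n k, ∀ c c' : ℝ,
    HasValue f θ c → HasValue f (act A θ) c' → c = c'

/-- The tautological jet with coordinates in the field of rational functions. -/
def genericJet (n k : ℕ) [NeZero n] : Jet (RatFun n k) n := fun v => toRat n k (X v)

/-- `Θ₀ = u` and the coefficients of `Θ_l⁰`, `l = 2, …, k`, as rational functions. -/
def formInvariants (n k : ℕ) [NeZero n] : Set (RatFun n k) :=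
  {f | f = genericJet n k (Sum.inr 0) ∨
    ∃ l, 2 ≤ l ∧ l ≤ k ∧ ∃ a : Fin l → Fin (n - 1), f = thetaCoeff (genericJet n k) l a}

/-! ### The data `(J, U, Γ)` and Tresse derivatives -/

/-- The frame fields as derivations: `e_a(f) = ∑_i (e_a)_i df/dx_i`. -/
def frameDeriv (a : Fin n) (f : RatFun n k) : RatFun n k :=
  ∑ i, frame (genericJet n k) a i * totalDeriv i f

/-- The matrix `(dJ_b/dx_i)` of the total differentials of `J_1, …, J_n`. -/
def jacobian (J : Fin n → RatFun n k) : Matrix (Fin n) (Fin n) (RatFun n k) :=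
  Matrix.of fun i b => totalDeriv i (J b)

/-- `J_1, …, J_n` are in general position: `d̂J_1 ∧ ⋯ ∧ d̂J_n ≠ 0`. -/
def GeneralPosition (J : Fin n → RatFun n k) : Prop := (jacobian J).det ≠ 0

/-- The Tresse derivative `df/dJ_b`, the solution of `d̂f = ∑_b (df/dJ_b) d̂J_b` (for `J` in general
position). -/
def tresse (J : Fin n → RatFun n k) (b : Fin n) (f : RatFun n k) : RatFun n k :=
  ((jacobian J)⁻¹.mulVec fun i => totalDeriv i f) b

/-- The iterated Tresse derivative `d/dJ_{b_1} ⋯ d/dJ_{b_r} f`. -/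
def iterTresse (J : Fin n → RatFun n k) (s : List (Fin n)) (f : RatFun n k) : RatFun n k :=
  s.foldr (tresse J) f

/-- `U_ab = e_a(J_b)`. -/
def dataU (J : Fin n → RatFun n k) (a b : Fin n) : RatFun n k := frameDeriv a (J b)

/-- The matrix whose rows are `e_1, …, e_n`. -/
def frameMatrix (n k : ℕ) [NeZero n] : Matrix (Fin n) (Fin n) (RatFun n k) :=
  Matrix.of (frame (genericJet n k))

/-- The Christoffel symbols: `∇̂_{e_a}(e_b) = ∑_c Γ_ab^c e_c`, where `∇̂` is the total lift of the
standard flat connection, so that the components of `∇̂_{e_a}(e_b)` are `e_a((e_b)_i)`. -/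
def christoffel (a b c : Fin n) : RatFun n k :=
  (Matrix.vecMul (fun i => frameDeriv a (frame (genericJet n k) b i)) (frameMatrix n k)⁻¹) c

/-- `J` and all the iterated Tresse derivatives, of orders `0, 1, 2, …`, of `U` and `Γ`. -/
def dataInvariants (J : Fin n → RatFun n k) : Set (RatFun n k) :=
  {f | (∃ b, f = J b) ∨
    (∃ s a b, f = iterTresse J s (dataU J a b)) ∨
    ∃ s a b c, f = iterTresse J s (christoffel a b c)}

end Invariants

end HomForms

end

/-!
At a jet `θ` of the Euler equation with `u ≠ 0` and nondegenerate `Θ₂`, the Euler equation says that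
the radial vector `δ̂` is `Θ₂`-orthogonal to `ker Θ₁` and that `Θ₁(δ̂) = k u ≠ 0`. Hence the
horizontal vectors split as `ker Θ₁ ⊕ ⟨δ̂⟩`, the form `Θ₂⁰` is nondegenerate, and `λ̂` and `Φ` are
given by rational expressions in the coordinates of the jet whose denominators are powers of `u` and
`det Θ₂` (`IsGoodJet.coe_lamHat`, `IsGoodJet.coe_kerFrame_succ`). These expressions hold over every
field of characteristic `0`, so that the frame of the tautological jet over the field of rational
functions takes at each such jet the value of the frame there (`RatOn`, `ratOn_frame`). Regularity
is the nonvanishing of one more determinant, so the regular jets are Zariski dense once there is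
one. The form `z ^ k + z ^ (k - 2) ∑ y_i² + z ^ (k - 3) ∑ c_i y_i³` provides it: there `λ̂ = (c_i)`
and `Φ = diag (c_i²)`, and the frame is a Vandermonde matrix with scaled columns
(`isRegularJet_modelJet`).

The frame is constructed naturally, so it is equivariant (`Carries.kerFrame_kerEquiv`), and the
coefficients of the tensors in it are invariant. Conversely, the inverse of the matrix with the
frame of `θ` as its columns moves a regular jet `θ` to a normal form in which the frame is the
standard basis. By the Euler equation all coordinates of the normal form are polynomials in `u` and
the coefficients of the `Θ_l⁰` (`normalJet_mem`). An invariant takes the same value at `θ` and at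
its normal form, hence is a rational function of these (`mem_adjoin_of_isInvariant`).

For the last part, the derivations along the frame are `e_a = ∑_b J_ab d/dJ_b`, so the field `L`
generated by `J` and the Tresse derivatives of `J_ab` and `Γ_ab^c` is closed under all `e_a`. The
coefficients of `Θ_{l+1}(e_a, …)` are, up to a factor, those of the covariant derivative of `Θ_l`
along `e_a`, which are obtained from the coefficients of `Θ_l` by `e_a` and the Christoffel symbols.
Starting with `Θ_0 = u ∈ L`, all coefficients lie in `L` (`applyOp_mem_of_mem_frameSpan_pow`). The
other inclusion holds because the pull-back under the action commutes with the `e_a`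
(`pull_frameDeriv`) and `d/dJ_b` is a combination of the `e_a` with invariant coefficients.
-/

noncomputable section

namespace HomForms

/-! ### Elementary properties of the universal tensors -/

section Tensors

variable {K : Type*} [Field K] {n : ℕ}

lemma applyOp_monomial (θ : Jet K n) (α : Fin n →₀ ℕ) (c : K) :
    applyOp θ (monomial α c) = c * θ (Sum.inr α) := by
  have h : monomial α c = c • basisMonomials (Fin n) K α := by
    simp [smul_monomial]
  rw [h, map_smul, applyOp, Module.Basis.constr_basis, smul_eq_mul]

lemma applyOp_one (θ : Jet K n) : applyOp θ 1 = θ (Sum.inr 0) := by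
  have := applyOp_monomial θ 0 1
  simpa using this

lemma dirOp_apply (Y : Fin n → K) : dirOp Y = ∑ i, Y i • (X i : MvPolynomial (Fin n) K) :=
  rfl

lemma dirOp_single (i : Fin n) :
    dirOp (Pi.single i (1 : K)) = (X i : MvPolynomial (Fin n) K) := by
  simp [dirOp_apply, Pi.single_apply]

lemma isHomogeneous_dirOp (Y : Fin n → K) : (dirOp Y).IsHomogeneous 1 := by
  rw [dirOp_apply]
  refine IsHomogeneous.sum _ _ _ fun i _ => ?_
  rw [smul_eq_C_mul]
  exact (isHomogeneous_X K i).C_mul _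

lemma applyOp_monomial_X_mul (θ : Jet K n) (i : Fin n) (α : Fin n →₀ ℕ) (c : K) :
    applyOp θ (X i * monomial α c) = c * θ (Sum.inr (α + oneAt i)) := by
  rw [mul_comm, X, monomial_mul, mul_one, applyOp_monomial]

lemma applyOp_dirOp (θ : Jet K n) (Y : Fin n → K) :
    applyOp θ (dirOp Y) = ∑ i, Y i * θ (Sum.inr (oneAt i)) := by
  simp only [dirOp_apply, map_sum, map_smul, X, applyOp_monomial, one_mul, smul_eq_mul]

lemma prod_dirOp {ι : Type*} [Fintype ι] [DecidableEq ι] (Y : ι → Fin n → K) :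
    ∏ j, dirOp (Y j) = ∑ m : ι → Fin n, (∏ j, Y j (m j)) •
      monomial (∑ j, oneAt (m j)) (1 : K) := by
  simp only [dirOp_apply, Finset.prod_univ_sum, Fintype.piFinset_univ]
  refine Finset.sum_congr rfl fun m _ => ?_
  rw [monomial_sum_one, ← Finset.prod_smul]
  rfl

/-- The expansion of a universal tensor in components. -/
lemma applyOp_prod_dirOp {ι : Type*} [Fintype ι] [DecidableEq ι] (θ : Jet K n)
    (Y : ι → Fin n → K) :
    applyOp θ (∏ j, dirOp (Y j)) =
      ∑ m : ι → Fin n, (∏ j, Y j (m j)) * θ (Sum.inr (∑ j, oneAt (m j))) := by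
  rw [prod_dirOp, map_sum]
  simp only [map_smul, applyOp_monomial, one_mul, smul_eq_mul]

lemma theta_zero (θ : Jet K n) (Y : Fin 0 → Fin n → K) : theta θ 0 Y = θ (Sum.inr 0) := by
  simp [theta, applyOp_one]

lemma theta_one (θ : Jet K n) (Y : Fin 1 → Fin n → K) :
    theta θ 1 Y = applyOp θ (dirOp (Y 0)) := by
  simp [theta]

lemma theta2_apply (θ : Jet K n) (Y Z : Fin n → K) : theta2 θ Y Z = theta θ 2 ![Y, Z] := rfl

lemma theta20_apply (θ : Jet K n) (Y Z : kerTheta1 θ) :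
    theta20 θ Y Z = theta θ 2 ![(Y : Fin n → K), (Z : Fin n → K)] := rfl

lemma theta30_apply (θ : Jet K n) (W Y Z : kerTheta1 θ) :
    theta30 θ W Y Z = theta θ 3 ![(W : Fin n → K), (Y : Fin n → K), (Z : Fin n → K)] := rfl

lemma theta2_comm (θ : Jet K n) (Y Z : Fin n → K) : theta2 θ Y Z = theta2 θ Z Y := by
  simp [theta2_apply, theta, Fin.prod_univ_two, mul_comm]

lemma mem_kerTheta1 {θ : Jet K n} {Y : Fin n → K} :
    Y ∈ kerTheta1 θ ↔ applyOp θ (dirOp Y) = 0 := by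
  simp [kerTheta1]

lemma sharp_spec {θ : Jet K n} (h : (theta20 θ).Nondegenerate)
    (φ : Module.Dual K (kerTheta1 θ)) : theta20 θ (sharp θ φ) = φ := by
  ext Z
  rw [sharp, dif_pos h]
  exact LinearMap.BilinForm.apply_toDual_symm_apply (hB := h) φ Z

lemma sharp_eq {θ : Jet K n} (h : (theta20 θ).Nondegenerate)
    {φ : Module.Dual K (kerTheta1 θ)} {w : kerTheta1 θ} (hw : theta20 θ w = φ) :
    sharp θ φ = w := by
  apply ((theta20 θ).toDual h).injective
  ext Z
  rw [LinearMap.BilinForm.toDual_def, LinearMap.BilinForm.toDual_def, sharp_spec h, hw]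

lemma cubicOp_apply (θ : Jet K n) (W Y : kerTheta1 θ) :
    cubicOp θ W Y = sharp θ (theta30 θ W Y) := rfl

lemma kerFrame_zero (θ : Jet K n) : kerFrame θ 0 = lamHat θ := rfl

lemma kerFrame_succ (θ : Jet K n) (a : ℕ) :
    kerFrame θ (a + 1) = cubicOp θ (lamHat θ) (kerFrame θ a) := by
  rw [kerFrame, pow_succ']; rfl

lemma frame_of_lt (θ : Jet K n) {a : Fin n} (h : a.val + 1 < n) :
    frame θ a = kerFrame θ a.val := by
  rw [frame, if_pos h]

lemma frame_last (θ : Jet K n) {a : Fin n} (h : a.val + 1 = n) :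
    frame θ a = fun i => θ (Sum.inl i) := by
  rw [frame, if_neg (by omega)]

end Tensors

/-! ### Naturality of the frame under linear isomorphisms -/

section Transport

variable {K : Type*} [Field K] {n : ℕ} {θ θ' : Jet K n}

/-- The linear isomorphism `e` carries the tensors `Θ_0, …, Θ_3` at `θ` to those at `θ'`. -/
def Carries (θ θ' : Jet K n) (e : (Fin n → K) ≃ₗ[K] (Fin n → K)) : Prop :=
  ∀ l ≤ 3, ∀ Y : Fin l → Fin n → K, theta θ' l (fun j => e (Y j)) = theta θ l Y

variable {e : (Fin n → K) ≃ₗ[K] (Fin n → K)}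

namespace Carries

lemma map_zero (h : Carries θ θ' e) : θ' (Sum.inr 0) = θ (Sum.inr 0) := by
  have := h 0 (by omega) ![]
  rwa [theta_zero, theta_zero] at this

lemma map_one (h : Carries θ θ' e) (Y : Fin n → K) :
    applyOp θ' (dirOp (e Y)) = applyOp θ (dirOp Y) := by
  have := h 1 (by omega) ![Y]
  rwa [theta_one, theta_one] at this

lemma map_two (h : Carries θ θ' e) (Y Z : Fin n → K) :
    theta θ' 2 ![e Y, e Z] = theta θ 2 ![Y, Z] := by
  rw [← h 2 (by omega) ![Y, Z]]
  congr 1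
  ext j
  fin_cases j <;> rfl

lemma map_three (h : Carries θ θ' e) (W Y Z : Fin n → K) :
    theta θ' 3 ![e W, e Y, e Z] = theta θ 3 ![W, Y, Z] := by
  rw [← h 3 (by omega) ![W, Y, Z]]
  congr 1
  ext j
  fin_cases j <;> rfl

/-- The isomorphism induced on the kernels of `Θ₁`. -/
def kerEquiv (h : Carries θ θ' e) : kerTheta1 θ ≃ₗ[K] kerTheta1 θ' :=
  e.ofSubmodules _ _ (by
    ext Z
    rw [Submodule.mem_map_equiv, mem_kerTheta1, mem_kerTheta1, ← h.map_one,
      LinearEquiv.apply_symm_apply])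

lemma coe_kerEquiv (h : Carries θ θ' e) (Y : kerTheta1 θ) :
    (h.kerEquiv Y : Fin n → K) = e Y := rfl

lemma theta20_kerEquiv (h : Carries θ θ' e) (Y Z : kerTheta1 θ) :
    theta20 θ' (h.kerEquiv Y) (h.kerEquiv Z) = theta20 θ Y Z := by
  simp only [theta20_apply, coe_kerEquiv, h.map_two]

lemma theta30_kerEquiv (h : Carries θ θ' e) (W Y Z : kerTheta1 θ) :
    theta30 θ' (h.kerEquiv W) (h.kerEquiv Y) (h.kerEquiv Z) = theta30 θ W Y Z := by
  simp only [theta30_apply, coe_kerEquiv, h.map_three]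

lemma nondegenerate_theta20_iff (h : Carries θ θ' e) :
    (theta20 θ').Nondegenerate ↔ (theta20 θ).Nondegenerate := by
  have : LinearMap.BilinForm.congr h.kerEquiv (theta20 θ) = theta20 θ' := by
    refine LinearMap.ext₂ fun Y Z => ?_
    rw [LinearMap.BilinForm.congr_apply, ← h.theta20_kerEquiv, LinearEquiv.apply_symm_apply,
      LinearEquiv.apply_symm_apply]
  rw [← this, LinearMap.BilinForm.nondegenerate_congr_iff]

lemma nondegenerate_theta2_iff (h : Carries θ θ' e) :
    (theta2 θ').Nondegenerate ↔ (theta2 θ).Nondegenerate := by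
  have : LinearMap.BilinForm.congr e (theta2 θ) = theta2 θ' := by
    refine LinearMap.ext₂ fun Y Z => ?_
    rw [LinearMap.BilinForm.congr_apply, theta2_apply, theta2_apply, ← h.map_two,
      LinearEquiv.apply_symm_apply, LinearEquiv.apply_symm_apply]
  rw [← this, LinearMap.BilinForm.nondegenerate_congr_iff]

/-- In the degenerate case both maps `sharp` are `0` by definition, so no hypothesis is needed. -/
lemma sharp_kerEquiv (h : Carries θ θ' e) (φ : Module.Dual K (kerTheta1 θ'))
    (ψ : Module.Dual K (kerTheta1 θ)) (hφ : ∀ Y, φ (h.kerEquiv Y) = ψ Y) :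
    sharp θ' φ = h.kerEquiv (sharp θ ψ) := by
  by_cases hn : (theta20 θ).Nondegenerate
  · apply sharp_eq (h.nondegenerate_theta20_iff.mpr hn)
    ext Z
    obtain ⟨Z, rfl⟩ := h.kerEquiv.surjective Z
    rw [theta20_kerEquiv, sharp_spec hn, hφ]
  · rw [sharp, dif_neg (h.nondegenerate_theta20_iff.not.mpr hn), sharp, dif_neg hn]
    simp

lemma cubicOp_kerEquiv (h : Carries θ θ' e) (W : kerTheta1 θ) :
    cubicOp θ' (h.kerEquiv W) = h.kerEquiv.conj (cubicOp θ W) := by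
  ext1 Y
  obtain ⟨Y, rfl⟩ := h.kerEquiv.surjective Y
  rw [LinearEquiv.conj_apply_apply, LinearEquiv.symm_apply_apply, cubicOp_apply, cubicOp_apply]
  exact h.sharp_kerEquiv _ _ fun Z => h.theta30_kerEquiv W Y Z

lemma lamHat_kerEquiv (h : Carries θ θ' e) : lamHat θ' = h.kerEquiv (lamHat θ) := by
  refine h.sharp_kerEquiv _ _ fun Y => ?_
  rw [lam, lam, LinearMap.comp_apply, LinearMap.comp_apply, h.cubicOp_kerEquiv,
    LinearMap.trace_conj']

lemma kerFrame_kerEquiv (h : Carries θ θ' e) (a : ℕ) :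
    kerFrame θ' a = h.kerEquiv (kerFrame θ a) := by
  induction a with
  | zero => exact h.lamHat_kerEquiv
  | succ a ih =>
    rw [kerFrame_succ, kerFrame_succ, ih, h.lamHat_kerEquiv, h.cubicOp_kerEquiv,
      LinearEquiv.conj_apply_apply, LinearEquiv.symm_apply_apply]

lemma coe_kerFrame (h : Carries θ θ' e) (a : ℕ) :
    (kerFrame θ' a : Fin n → K) = e (kerFrame θ a) := by
  rw [h.kerFrame_kerEquiv, coe_kerEquiv]

lemma isRegularJet_iff (h : Carries θ θ' e) : IsRegularJet θ' ↔ IsRegularJet θ := by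
  unfold IsRegularJet
  rw [h.map_zero, h.nondegenerate_theta2_iff,
    ← LinearMap.linearIndependent_iff (h.kerEquiv : kerTheta1 θ →ₗ[K] kerTheta1 θ')
      (LinearEquiv.ker _)]
  simp only [Function.comp_def, h.kerFrame_kerEquiv, LinearEquiv.coe_coe]

end Carries

/-- Jets with the same 3-jet have the same tensors `Θ_0, …, Θ_3`. -/
lemma Carries.of_eq (h : ∀ α : Fin n →₀ ℕ, α.degree ≤ 3 → θ (Sum.inr α) = θ' (Sum.inr α)) :
    Carries θ θ' (LinearEquiv.refl K _) := by
  intro l hl Y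
  simp only [LinearEquiv.refl_apply, theta, applyOp_prod_dirOp]
  congr 1
  refine Finset.sum_congr rfl fun m _ => ?_
  rw [h]
  simpa using hl

lemma frame_eq_of_eq (hx : ∀ i, θ (Sum.inl i) = θ' (Sum.inl i))
    (h : ∀ α : Fin n →₀ ℕ, α.degree ≤ 3 → θ (Sum.inr α) = θ' (Sum.inr α)) :
    frame θ = frame θ' := by
  funext a
  rw [frame, frame, (Carries.of_eq h).coe_kerFrame]
  simp only [hx, LinearEquiv.refl_apply]

end Transport

/-! ### The Euler equation over a field -/

section Euler

variable {K : Type*} [Field K] {n k : ℕ} {θ : Jet K n}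

/-- The Euler equation of homogeneous `k`-forms with its prolongations, for jets with coordinates
in an arbitrary field. The condition that the base point is not `0` is not included. -/
structure IsEulerJet (k : ℕ) (θ : Jet K n) : Prop where
  euler : ∀ α : Fin n →₀ ℕ, α.degree < k →
    ∑ i, θ (Sum.inl i) * θ (Sum.inr (α + oneAt i)) = ((k : K) - α.degree) * θ (Sum.inr α)
  zero : ∀ β : Fin n →₀ ℕ, k < β.degree → θ (Sum.inr β) = 0

lemma mem_eulerEq {θ : Jet ℝ n} :
    θ ∈ eulerEq n k ↔ (∃ i, θ (Sum.inl i) ≠ 0) ∧ IsEulerJet k θ :=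
  ⟨fun h => ⟨h.1, h.2.1, h.2.2⟩, fun h => ⟨h.1, h.2.euler, h.2.zero⟩⟩

/-- The components of the radial field. -/
def rad (θ : Jet K n) : Fin n → K := fun i => θ (Sum.inl i)

lemma applyOp_eq_sum (θ : Jet K n) (p : MvPolynomial (Fin n) K) :
    applyOp θ p = ∑ α ∈ p.support, p.coeff α * θ (Sum.inr α) := by
  conv_lhs => rw [p.as_sum]
  simp only [map_sum, applyOp_monomial]

namespace IsEulerJet

lemma applyOp_eq_zero (h : IsEulerJet k θ) {p : MvPolynomial (Fin n) K} {d : ℕ}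
    (hp : p.IsHomogeneous d) (hd : k < d) : applyOp θ p = 0 := by
  rw [applyOp_eq_sum]
  refine Finset.sum_eq_zero fun α hα => ?_
  have : α.degree = d := by
    by_contra hne
    exact mem_support_iff.mp hα (hp.coeff_eq_zero hne)
  rw [h.zero α (by omega), mul_zero]

/-- The Euler equation: a homogeneous operator of order `d`, applied after the radial derivative, is
multiplication by `k - d`. -/
lemma applyOp_dirOp_rad_mul (h : IsEulerJet k θ) {p : MvPolynomial (Fin n) K} {d : ℕ}
    (hp : p.IsHomogeneous d) (hd : d < k) :
    applyOp θ (dirOp (rad θ) * p) = ((k : K) - d) * applyOp θ p := by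
  rw [applyOp_eq_sum θ p, Finset.mul_sum]
  conv_lhs => rw [p.as_sum]
  rw [Finset.mul_sum, map_sum]
  refine Finset.sum_congr rfl fun α hα => ?_
  have hα : α.degree = d := by
    by_contra hne
    exact mem_support_iff.mp hα (hp.coeff_eq_zero hne)
  rw [dirOp_apply, Finset.sum_mul, map_sum]
  simp only [smul_mul_assoc, map_smul, applyOp_monomial_X_mul, smul_eq_mul]
  have := h.euler α (by omega)
  rw [hα] at this
  calc _ = p.coeff α * ∑ i, θ (Sum.inl i) * θ (Sum.inr (α + oneAt i)) := by
        rw [Finset.mul_sum]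
        exact Finset.sum_congr rfl fun i _ => by rw [rad]; ring
    _ = _ := by rw [this]; ring

lemma applyOp_dirOp_rad (h : IsEulerJet k θ) (hk : 0 < k) :
    applyOp θ (dirOp (rad θ)) = k * θ (Sum.inr 0) := by
  simpa [applyOp_one] using h.applyOp_dirOp_rad_mul (isHomogeneous_one _ _) hk

/-- The radial vector is `Θ₂`-orthogonal to `ker Θ₁`. -/
lemma theta2_rad (h : IsEulerJet k θ) (hk : 1 < k) {Y : Fin n → K}
    (hY : Y ∈ kerTheta1 θ) : theta2 θ (rad θ) Y = 0 := by
  have := h.applyOp_dirOp_rad_mul (isHomogeneous_dirOp Y) hk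
  rw [mem_kerTheta1.mp hY, mul_zero] at this
  simp [theta2_apply, theta, Fin.prod_univ_two, this]

end IsEulerJet

end Euler

/-! ### The frame in coordinates -/

section Coordinates

variable {K : Type*} [Field K] {n k : ℕ} {θ : Jet K n}

/-- The matrix of `Θ₂`. -/
def gram (θ : Jet K n) : Matrix (Fin n) (Fin n) K :=
  Matrix.of fun i j => theta θ 2 ![Pi.single i 1, Pi.single j 1]

lemma gram_eq (θ : Jet K n) : gram θ = LinearMap.BilinForm.toMatrix' (theta2 θ) := by
  ext i j
  rw [LinearMap.BilinForm.toMatrix'_apply]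
  rfl

lemma nondegenerate_theta2_iff_det : (theta2 θ).Nondegenerate ↔ (gram θ).det ≠ 0 := by
  rw [gram_eq, ← Matrix.nondegenerate_iff_det_ne_zero,
    LinearMap.BilinForm.nondegenerate_toMatrix'_iff]

lemma gram_mulVec (θ : Jet K n) (Y : Fin n → K) (i : Fin n) :
    (gram θ).mulVec Y i = theta2 θ (Pi.single i 1) Y := by
  have hY : Y = ∑ j, Y j • (Pi.single j 1 : Fin n → K) := by
    ext j
    simp [Pi.single_apply]
  conv_rhs => rw [hY, map_sum]
  rw [Matrix.mulVec, dotProduct]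
  refine Finset.sum_congr rfl fun j _ => ?_
  rw [map_smul, smul_eq_mul, mul_comm]
  rfl

/-- The jets at which the construction of the frame makes sense: the Euler equation holds, `u ≠ 0`,
and `Θ₂` is nondegenerate. -/
structure IsGoodJet (k : ℕ) (θ : Jet K n) : Prop extends IsEulerJet k θ where
  u_ne_zero : θ (Sum.inr 0) ≠ 0
  nondegenerate : (theta2 θ).Nondegenerate

/-- The projection of a vector to `ker Θ₁` along the radial direction,
`Y ↦ Y - (k u)⁻¹ Θ₁(Y) δ̂` (meaningful for `u ≠ 0`), with values in all vectors. -/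
def projVec (k : ℕ) (θ : Jet K n) : (Fin n → K) →ₗ[K] (Fin n → K) :=
  LinearMap.id - ((applyOp θ ∘ₗ dirOp).smulRight ((k * θ (Sum.inr 0))⁻¹ • rad θ))

lemma projVec_apply (Y : Fin n → K) :
    projVec k θ Y = Y - (applyOp θ (dirOp Y) * (k * θ (Sum.inr 0))⁻¹) • rad θ := by
  simp [projVec, smul_smul]

namespace IsGoodJet

lemma theta2_projVec (h : IsGoodJet k θ) (hk : 3 ≤ k) (Y : Fin n → K) (Z : kerTheta1 θ) :
    theta2 θ (projVec k θ Y) Z = theta2 θ Y Z := by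
  rw [projVec_apply, map_sub, map_smul, LinearMap.sub_apply, LinearMap.smul_apply,
    h.theta2_rad (by omega) Z.2]
  simp

variable [CharZero K]

lemma projVec_mem (h : IsGoodJet k θ) (hk : 3 ≤ k) (Y : Fin n → K) :
    projVec k θ Y ∈ kerTheta1 θ := by
  have h0 : (k : K) ≠ 0 := by exact_mod_cast (show k ≠ 0 by omega)
  have := h.u_ne_zero
  rw [mem_kerTheta1, projVec_apply, map_sub, map_sub, map_smul, map_smul,
    h.applyOp_dirOp_rad (by omega)]
  simp
  field_simp
  ring

/-- `projVec` with values in `ker Θ₁`. -/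
def proj (h : IsGoodJet k θ) (hk : 3 ≤ k) : (Fin n → K) →ₗ[K] kerTheta1 θ :=
  (projVec k θ).codRestrict _ (h.projVec_mem hk)

lemma coe_proj (h : IsGoodJet k θ) (hk : 3 ≤ k) (Y : Fin n → K) :
    (h.proj hk Y : Fin n → K) = projVec k θ Y := rfl

lemma proj_coe (h : IsGoodJet k θ) (hk : 3 ≤ k) (Y : kerTheta1 θ) : h.proj hk Y = Y := by
  ext1
  rw [coe_proj, projVec_apply, mem_kerTheta1.mp Y.2]
  simp

lemma nondegenerate_theta20 (h : IsGoodJet k θ) (hk : 3 ≤ k) : (theta20 θ).Nondegenerate := by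
  have hs : (theta20 θ).IsRefl := fun Y Z hYZ => by
    have := theta2_comm θ Y Z
    exact this.symm.trans hYZ
  refine hs.nondegenerate_iff_separatingRight.mpr ?_
  intro Z hZ
  ext1
  refine h.nondegenerate.2 _ fun Y => ?_
  rw [← h.theta2_projVec hk]
  exact hZ (h.proj hk Y)

/-- On `ker Θ₁`, the inverse of `Θ₂⁰` is the inverse of `Θ₂` on the forms extended by `0` to the
radial direction. -/
lemma coe_sharp (h : IsGoodJet k θ) (hk : 3 ≤ k) (φ : Module.Dual K (kerTheta1 θ)) :
    (sharp θ φ : Fin n → K) =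
      (gram θ)⁻¹.mulVec fun b => φ (h.proj hk (Pi.single b 1)) := by
  have hdet : IsUnit (gram θ).det := (nondegenerate_theta2_iff_det.mp h.nondegenerate).isUnit
  have hg : (gram θ).mulVec (sharp θ φ) = fun b => φ (h.proj hk (Pi.single b 1)) := by
    funext b
    rw [gram_mulVec, ← h.theta2_projVec hk, theta2_comm, ← h.coe_proj hk]
    exact congrArg (fun ψ => ψ (h.proj hk (Pi.single b 1)))
      (sharp_spec (h.nondegenerate_theta20 hk) φ)
  rw [← hg, Matrix.mulVec_mulVec, Matrix.nonsing_inv_mul _ hdet, Matrix.one_mulVec]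

lemma coe_cubicOp (h : IsGoodJet k θ) (hk : 3 ≤ k) (W Y : kerTheta1 θ) :
    (cubicOp θ W Y : Fin n → K) = (gram θ)⁻¹.mulVec fun b =>
      theta θ 3 ![(W : Fin n → K), (Y : Fin n → K), projVec k θ (Pi.single b 1)] :=
  h.coe_sharp hk _

lemma lam_apply (h : IsGoodJet k θ) (hk : 3 ≤ k) (W : kerTheta1 θ) :
    lam θ W = ∑ c, (gram θ)⁻¹.mulVec (fun b => theta θ 3 ![(W : Fin n → K),
      projVec k θ (Pi.single c 1), projVec k θ (Pi.single b 1)]) c := by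
  -- The trace over `ker Θ₁` is the trace of the operator extended by `0` to the radial direction.
  have h1 : (cubicOp θ W ∘ₗ h.proj hk) ∘ₗ (kerTheta1 θ).subtype = cubicOp θ W := by
    ext1 Y
    simp [h.proj_coe hk]
  rw [lam, LinearMap.comp_apply, ← h1, ← LinearMap.trace_comp_comm',
    LinearMap.trace_eq_matrix_trace K (Pi.basisFun K (Fin n)), Matrix.trace]
  refine Finset.sum_congr rfl fun c _ => ?_
  rw [Matrix.diag_apply, LinearMap.toMatrix_apply, ← h.coe_proj hk, ← h.coe_cubicOp hk]
  simp

/-- The first vector of the frame, as a rational expression in the coordinates of the jet. -/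
lemma coe_lamHat (h : IsGoodJet k θ) (hk : 3 ≤ k) :
    (lamHat θ : Fin n → K) = (gram θ)⁻¹.mulVec fun a => ∑ c, (gram θ)⁻¹.mulVec (fun b =>
      theta θ 3 ![projVec k θ (Pi.single a 1), projVec k θ (Pi.single c 1),
        projVec k θ (Pi.single b 1)]) c := by
  rw [lamHat, h.coe_sharp hk]
  simp only [h.lam_apply hk, h.coe_proj]

lemma coe_kerFrame_succ (h : IsGoodJet k θ) (hk : 3 ≤ k) (a : ℕ) :
    (kerFrame θ (a + 1) : Fin n → K) = (gram θ)⁻¹.mulVec fun b =>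
      theta θ 3 ![(lamHat θ : Fin n → K), (kerFrame θ a : Fin n → K),
        projVec k θ (Pi.single b 1)] := by
  rw [kerFrame_succ, h.coe_cubicOp hk]

/-- Over the jets with `u ≠ 0` and nondegenerate `Θ₂`, the vectors `e_1, …, e_n` are linearly
independent as soon as `e_1, …, e_{n-1}` are, since `Θ₁` is not zero on the radial vector. -/
lemma linearIndependent_frame_iff (h : IsGoodJet k θ) (hk : 3 ≤ k) (hn : 0 < n) :
    LinearIndependent K (frame θ) ↔
      LinearIndependent K fun a : Fin (n - 1) => kerFrame θ a.val := by
  obtain ⟨m, rfl⟩ : ∃ m, n = m + 1 := ⟨n - 1, by omega⟩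
  have hf : frame θ = Fin.snoc (α := fun _ => Fin (m + 1) → K)
      (fun a : Fin m => (kerFrame θ a.val : Fin (m + 1) → K)) (rad θ) := by
    funext a
    refine Fin.lastCases ?_ (fun a => ?_) a
    · rw [frame_last θ (by simp), Fin.snoc_last]; rfl
    · rw [frame_of_lt θ (by simp), Fin.snoc_castSucc]; rfl
  have hk0 : (k : K) ≠ 0 := by exact_mod_cast (show k ≠ 0 by omega)
  rw [hf, linearIndependent_finSnoc]
  have hsub : LinearIndependent K (fun a : Fin m => (kerFrame θ a.val : Fin (m + 1) → K)) ↔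
      LinearIndependent K fun a : Fin m => kerFrame θ a.val :=
    LinearMap.linearIndependent_iff (kerTheta1 θ).subtype (Submodule.ker_subtype _)
  rw [hsub]
  refine and_iff_left fun hmem => ?_
  have hle : Submodule.span K (Set.range fun a : Fin m => (kerFrame θ a.val : Fin (m + 1) → K)) ≤
      kerTheta1 θ := by
    rw [Submodule.span_le]
    rintro _ ⟨a, rfl⟩
    exact (kerFrame θ a.val).2
  have := mem_kerTheta1.mp (hle hmem)
  rw [h.applyOp_dirOp_rad (by omega)] at this
  exact mul_ne_zero hk0 h.u_ne_zero this

end IsGoodJet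

end Coordinates

/-! ### A regular jet -/

section Model

variable {n k : ℕ}

/-- The partial derivatives at `0` of `1 + ∑ y_i² + ∑ (i + 1) y_i³`, the sums extending over the
variables `y_i` with `i ≠ ℓ`. -/
def modelCoeff (ℓ : Fin n) (γ : Fin n →₀ ℕ) : ℝ :=
  (if γ = 0 then 1 else 0) + ∑ i ∈ Finset.univ.erase ℓ,
    ((if γ = Finsupp.single i 2 then 2 else 0) +
      if γ = Finsupp.single i 3 then 6 * ((i.val : ℝ) + 1) else 0)

/-- The jet at the `ℓ`-th basis vector of the `k`-form
`z ^ k + z ^ (k - 2) ∑ y_i² + z ^ (k - 3) ∑ (i + 1) y_i³`, where `z` is the `ℓ`-th coordinate and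
the `y_i` are the others. The falling factorial comes from differentiating a power of `z` at
`z = 1`. -/
def modelJet (k : ℕ) (ℓ : Fin n) : Jet ℝ n :=
  Sum.elim (Pi.single ℓ 1) fun β =>
    modelCoeff ℓ (β.erase ℓ) * ((k - (β.erase ℓ).degree).descFactorial (β ℓ) : ℕ)

lemma modelCoeff_eq_zero (ℓ : Fin n) {γ : Fin n →₀ ℕ} (h0 : γ.degree ≠ 0) (h2 : γ.degree ≠ 2)
    (h3 : γ.degree ≠ 3) : modelCoeff ℓ γ = 0 := by
  rw [modelCoeff, if_neg (by rintro rfl; simp at h0), zero_add]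
  refine Finset.sum_eq_zero fun i _ => ?_
  rw [if_neg (by rintro rfl; simp at h2), if_neg (by rintro rfl; simp at h3), zero_add]

lemma modelCoeff_zero (ℓ : Fin n) : modelCoeff ℓ 0 = 1 := by
  have h : ∀ (i : Fin n) (m : ℕ), m ≠ 0 → (0 : Fin n →₀ ℕ) ≠ Finsupp.single i m :=
    fun i m hm h0 => hm (by simpa using congrArg Finsupp.degree h0.symm)
  simp [modelCoeff, h]

lemma degree_erase_add (ℓ : Fin n) (β : Fin n →₀ ℕ) : (β.erase ℓ).degree + β ℓ = β.degree := by
  conv_rhs => rw [← Finsupp.erase_add_single ℓ β]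
  simp

lemma isEulerJet_modelJet (hk : 3 ≤ k) (ℓ : Fin n) : IsEulerJet k (modelJet k ℓ) := by
  constructor
  · intro α hα
    have hd := degree_erase_add ℓ α
    have he : (α + oneAt ℓ).erase ℓ = α.erase ℓ := by
      rw [Finsupp.erase_add, Finsupp.erase_single, add_zero]
    rw [Finset.sum_eq_single ℓ (by intro i _ hi; simp [modelJet, hi]) (by simp)]
    simp only [modelJet, Sum.elim_inl, Sum.elim_inr, he, Pi.single_eq_same, one_mul,
      Finsupp.add_apply, Finsupp.single_eq_same, Nat.descFactorial_succ]
    rw [Nat.cast_mul, Nat.cast_sub (by omega), Nat.cast_sub (by omega), ← hd]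
    push_cast
    ring
  · intro β hβ
    have hd := degree_erase_add ℓ β
    simp only [modelJet, Sum.elim_inr]
    by_cases h : (β.erase ℓ).degree ≤ k
    · rw [Nat.descFactorial_eq_zero_iff_lt.mpr (by omega), Nat.cast_zero, mul_zero]
    · rw [modelCoeff_eq_zero ℓ (by omega) (by omega) (by omega), zero_mul]

variable {ℓ : Fin n}

lemma modelJet_of_ne {β : Fin n →₀ ℕ} (h : β ℓ = 0) :
    modelJet k ℓ (Sum.inr β) = modelCoeff ℓ β := by
  simp [modelJet, h]

lemma modelJet_zero : modelJet k ℓ (Sum.inr 0) = 1 := by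
  rw [modelJet_of_ne (by simp), modelCoeff_zero]

lemma modelJet_one (a : Fin n) :
    modelJet k ℓ (Sum.inr (oneAt a)) = if a = ℓ then (k : ℝ) else 0 := by
  split_ifs with h
  · subst h
    simp [modelJet, modelCoeff_zero]
  · rw [modelJet_of_ne (by simp [h]), modelCoeff_eq_zero] <;> simp

lemma modelJet_two (a b : Fin n) :
    modelJet k ℓ (Sum.inr (oneAt a + oneAt b)) =
      if a = b then (if a = ℓ then (k : ℝ) * (k - 1 : ℕ) else 2) else 0 := by
  by_cases ha : a = ℓ
  · subst ha
    by_cases hb : b = a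
    · subst hb
      simp [modelJet, modelCoeff_zero, Finsupp.erase_add, Nat.descFactorial_succ, mul_comm]
    · have : ((oneAt a + oneAt b).erase a).degree = 1 := by
        rw [Finsupp.erase_add, Finsupp.erase_single, Finsupp.erase_single_ne (Ne.symm hb)]
        simp
      simp only [modelJet, Sum.elim_inr]
      rw [modelCoeff_eq_zero _ (by omega) (by omega) (by omega), zero_mul, if_neg (Ne.symm hb)]
  · by_cases hb : b = ℓ
    · subst hb
      have : ((oneAt a + oneAt b).erase b).degree = 1 := by
        rw [Finsupp.erase_add, Finsupp.erase_single, Finsupp.erase_single_ne (Ne.symm ha)]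
        simp
      simp only [modelJet, Sum.elim_inr]
      rw [modelCoeff_eq_zero _ (by omega) (by omega) (by omega), zero_mul, if_neg ha]
    · rw [modelJet_of_ne (by simp [ha, hb]), modelCoeff]
      have h0 : oneAt a + oneAt b ≠ 0 := fun h => by
        simpa using congrArg Finsupp.degree h
      have h2 : ∀ i, oneAt a + oneAt b = Finsupp.single i 2 ↔ i = a ∧ a = b := by
        intro i
        constructor
        · intro h
          have := congrArg (fun γ => γ i) h
          simp only [Finsupp.add_apply, Finsupp.single_apply, if_true] at this
          split_ifs at this <;> simp_all
        · rintro ⟨rfl, rfl⟩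
          rw [← Finsupp.single_add]
      have h3 : ∀ i, oneAt a + oneAt b ≠ Finsupp.single i 3 := fun i h => by
        simpa using congrArg Finsupp.degree h
      simp only [h0, h2, h3, if_false, zero_add, add_zero, ite_and]
      rw [Finset.sum_ite_eq' (Finset.univ.erase ℓ) a]
      simp [ha]

lemma modelJet_three {a b c : Fin n} (ha : a ≠ ℓ) (hb : b ≠ ℓ) (hc : c ≠ ℓ) :
    modelJet k ℓ (Sum.inr (oneAt a + oneAt b + oneAt c)) =
      if a = b then (if a = c then 6 * ((a.val : ℝ) + 1) else 0) else 0 := by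
  rw [modelJet_of_ne (by simp [ha, hb, hc]), modelCoeff]
  have h0 : oneAt a + oneAt b + oneAt c ≠ 0 := fun h => by
    simpa using congrArg Finsupp.degree h
  have h2 : ∀ i, oneAt a + oneAt b + oneAt c ≠ Finsupp.single i 2 := fun i h => by
    simpa using congrArg Finsupp.degree h
  have h3 : ∀ i, oneAt a + oneAt b + oneAt c = Finsupp.single i 3 ↔ i = a ∧ a = b ∧ a = c := by
    intro i
    constructor
    · intro h
      have := congrArg (fun γ => γ i) h
      simp only [Finsupp.add_apply, Finsupp.single_apply, if_true] at this
      split_ifs at this <;> simp_all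
    · rintro ⟨rfl, rfl, rfl⟩
      rw [← Finsupp.single_add, ← Finsupp.single_add]
  simp only [h0, h2, h3, if_false, zero_add, ite_and]
  rw [Finset.sum_ite_eq' (Finset.univ.erase ℓ) a]
  simp [ha]

lemma mem_kerTheta1_modelJet (hk : 3 ≤ k) {Y : Fin n → ℝ} :
    Y ∈ kerTheta1 (modelJet k ℓ) ↔ Y ℓ = 0 := by
  have : (k : ℝ) ≠ 0 := by exact_mod_cast (show k ≠ 0 by omega)
  rw [mem_kerTheta1, applyOp_dirOp]
  simp [modelJet_one, this]

lemma theta_two_single (θ : Jet ℝ n) (a b : Fin n) :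
    theta θ 2 ![Pi.single a 1, Pi.single b 1] = θ (Sum.inr (oneAt a + oneAt b)) / 2 := by
  simp only [theta, Fin.prod_univ_two, Matrix.cons_val_zero, Matrix.cons_val_one, dirOp_single]
  rw [X, X, monomial_mul, applyOp_monomial]
  norm_num
  ring

lemma gram_modelJet : gram (modelJet k ℓ) =
    Matrix.diagonal fun a => if a = ℓ then (k : ℝ) * (k - 1 : ℕ) / 2 else 1 := by
  ext a b
  rw [gram, Matrix.of_apply, theta_two_single, modelJet_two, Matrix.diagonal_apply]
  split_ifs <;> simp

/-- On `ker Θ₁`, which is spanned by the other basis vectors, `Θ₃` at the model jet is the diagonal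
cubic form. -/
lemma theta_three_modelJet (hk : 3 ≤ k) {W Y Z : Fin n → ℝ} (hW : W ∈ kerTheta1 (modelJet k ℓ))
    (hY : Y ∈ kerTheta1 (modelJet k ℓ)) (hZ : Z ∈ kerTheta1 (modelJet k ℓ)) :
    theta (modelJet k ℓ) 3 ![W, Y, Z] = ∑ a, ((a.val : ℝ) + 1) * (W a * Y a * Z a) := by
  rw [mem_kerTheta1_modelJet hk] at hW hY hZ
  have hexp : dirOp W * dirOp Y * dirOp Z = ∑ a, ∑ b, ∑ c,
      (W a * Y b * Z c) • monomial (oneAt a + oneAt b + oneAt c) (1 : ℝ) := by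
    rw [dirOp_apply, dirOp_apply, dirOp_apply, Finset.sum_mul_sum, Finset.sum_mul]
    refine Finset.sum_congr rfl fun a _ => ?_
    rw [Finset.sum_mul_sum]
    refine Finset.sum_congr rfl fun b _ => Finset.sum_congr rfl fun c _ => ?_
    rw [smul_mul_smul_comm, smul_mul_smul_comm, X, X, X, monomial_mul, monomial_mul, one_mul,
      one_mul]
  have hv : ∀ a b c, (W a * Y b * Z c) *
      modelJet k ℓ (Sum.inr (oneAt a + oneAt b + oneAt c)) =
      if a = b then (if a = c then 6 * ((a.val : ℝ) + 1) * (W a * Y a * Z a) else 0) else 0 := by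
    intro a b c
    by_cases ha : a = ℓ
    · simp [ha, hW]
    by_cases hb : b = ℓ
    · simp [hb, hY, ha]
    by_cases hc : c = ℓ
    · simp [hc, hZ, ha]
    rw [modelJet_three ha hb hc]
    split_ifs with h1 h2
    · subst h1 h2; ring
    · simp
    · simp
  rw [theta, Fin.prod_univ_three]
  simp only [Matrix.cons_val_zero, Matrix.cons_val_one, Matrix.cons_val]
  rw [hexp]
  simp only [map_sum, map_smul, applyOp_monomial, one_mul, smul_eq_mul, hv]
  rw [Finset.mul_sum]
  refine Finset.sum_congr rfl fun a _ => ?_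
  norm_num [Nat.factorial]
  ring

lemma isGoodJet_modelJet (hk : 3 ≤ k) (ℓ : Fin n) : IsGoodJet k (modelJet k ℓ) where
  toIsEulerJet := isEulerJet_modelJet hk ℓ
  u_ne_zero := by simp [modelJet_zero]
  nondegenerate := by
    rw [nondegenerate_theta2_iff_det, gram_modelJet, Matrix.det_diagonal, Finset.prod_ne_zero_iff]
    intro a _
    have h1 : (k : ℝ) ≠ 0 := by exact_mod_cast (show k ≠ 0 by omega)
    have h2 : ((k - 1 : ℕ) : ℝ) ≠ 0 := by exact_mod_cast (show k - 1 ≠ 0 by omega)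
    split_ifs
    · positivity
    · exact one_ne_zero

lemma gram_inv_modelJet (hk : 3 ≤ k) (v : Fin n → ℝ) {a : Fin n} (ha : a ≠ ℓ) :
    (gram (modelJet k ℓ))⁻¹.mulVec v a = v a := by
  have hdet := (nondegenerate_theta2_iff_det.mp (isGoodJet_modelJet hk ℓ).nondegenerate).isUnit
  have h : (gram (modelJet k ℓ)).mulVec ((gram (modelJet k ℓ))⁻¹.mulVec v) a = v a := by
    rw [Matrix.mulVec_mulVec, Matrix.mul_nonsing_inv _ hdet, Matrix.one_mulVec]
  conv_lhs at h => rw [gram_modelJet, Matrix.mulVec_diagonal, if_neg ha, one_mul,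
    ← gram_modelJet]
  exact h

lemma single_mem_kerTheta1_modelJet (hk : 3 ≤ k) {a : Fin n} (ha : a ≠ ℓ) :
    Pi.single a 1 ∈ kerTheta1 (modelJet k ℓ) := by
  rw [mem_kerTheta1_modelJet hk, Pi.single_eq_of_ne (Ne.symm ha)]

lemma projVec_single_modelJet (hk : 3 ≤ k) {a : Fin n} (ha : a ≠ ℓ) :
    projVec k (modelJet k ℓ) (Pi.single a 1) = Pi.single a 1 := by
  have := (isGoodJet_modelJet hk ℓ).proj_coe hk ⟨_, single_mem_kerTheta1_modelJet hk ha⟩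
  exact congrArg Subtype.val this

lemma cubicOp_modelJet (hk : 3 ≤ k) (W Y : kerTheta1 (modelJet k ℓ)) {a : Fin n} (ha : a ≠ ℓ) :
    (cubicOp _ W Y : Fin n → ℝ) a =
      ((a.val : ℝ) + 1) * ((W : Fin n → ℝ) a * (Y : Fin n → ℝ) a) := by
  rw [(isGoodJet_modelJet hk ℓ).coe_cubicOp hk, gram_inv_modelJet hk _ ha,
    projVec_single_modelJet hk ha,
    theta_three_modelJet hk W.2 Y.2 (single_mem_kerTheta1_modelJet hk ha)]
  simp [Pi.single_apply]

lemma projVec_single_self_modelJet (hk : 3 ≤ k) :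
    projVec k (modelJet k ℓ) (Pi.single ℓ 1) = 0 := by
  have hk0 : (k : ℝ) ≠ 0 := by exact_mod_cast (show k ≠ 0 by omega)
  have hr : rad (modelJet k ℓ) = Pi.single ℓ 1 := rfl
  rw [projVec_apply, ← hr, (isEulerJet_modelJet hk ℓ).applyOp_dirOp_rad (by omega), modelJet_zero,
    mul_inv_cancel₀ (by simpa using hk0), one_smul, sub_self]

lemma lamHat_modelJet (hk : 3 ≤ k) {a : Fin n} (ha : a ≠ ℓ) :
    (lamHat (modelJet k ℓ) : Fin n → ℝ) a = (a.val : ℝ) + 1 := by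
  have hg := isGoodJet_modelJet (k := k) hk ℓ
  rw [lamHat, hg.coe_sharp hk, gram_inv_modelJet hk _ ha]
  have hlam : ∀ W, lam (modelJet k ℓ) W = ∑ c ∈ Finset.univ.erase ℓ,
      ((c.val : ℝ) + 1) * (W : Fin n → ℝ) c := by
    intro W
    rw [hg.lam_apply hk, ← Finset.add_sum_erase _ _ (Finset.mem_univ ℓ),
      projVec_single_self_modelJet hk]
    have h0 : ∀ b, theta (modelJet k ℓ) 3
        ![(W : Fin n → ℝ), 0, projVec k (modelJet k ℓ) (Pi.single b 1)] = 0 := by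
      intro b
      simp [theta, Fin.prod_univ_three]
    simp only [h0]
    rw [show (fun _ : Fin n => (0 : ℝ)) = 0 from rfl, Matrix.mulVec_zero, Pi.zero_apply, zero_add]
    refine Finset.sum_congr rfl fun c hc => ?_
    have hc := Finset.ne_of_mem_erase hc
    rw [gram_inv_modelJet hk _ hc, projVec_single_modelJet hk hc,
      theta_three_modelJet hk W.2 (single_mem_kerTheta1_modelJet hk hc)
        (single_mem_kerTheta1_modelJet hk hc)]
    simp [Pi.single_apply]
  rw [hlam, hg.coe_proj, projVec_single_modelJet hk ha]
  simp [Pi.single_apply, ha]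

lemma kerFrame_modelJet (hk : 3 ≤ k) (j : ℕ) {a : Fin n} (ha : a ≠ ℓ) :
    (kerFrame (modelJet k ℓ) j : Fin n → ℝ) a =
      ((a.val : ℝ) + 1) * (((a.val : ℝ) + 1) ^ 2) ^ j := by
  induction j with
  | zero => rw [kerFrame_zero, lamHat_modelJet hk ha, pow_zero, mul_one]
  | succ j ih => rw [kerFrame_succ, cubicOp_modelJet hk _ _ ha, lamHat_modelJet hk ha, ih]; ring

/-- The model jet is regular: the matrix of components of its frame is a Vandermonde matrix up to
the scaling of its columns. -/
lemma isRegularJet_modelJet (hk : 3 ≤ k) (hℓ : ℓ.val + 1 = n) :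
    IsRegularJet (modelJet k ℓ) := by
  have hg := isGoodJet_modelJet (k := k) hk ℓ
  refine ⟨hg.u_ne_zero, hg.nondegenerate, ?_⟩
  rw [Fintype.linearIndependent_iff]
  intro g hsum
  let ι : Fin (n - 1) → Fin n := Fin.castLE (by omega)
  have hι : ∀ i, ι i ≠ ℓ := fun i h => by
    have := congrArg Fin.val h
    have := i.2
    simp only [ι, Fin.val_castLE] at *
    omega
  let v : Fin (n - 1) → ℝ := fun i => ((i.val : ℝ) + 1) ^ 2
  have hv : Function.Injective v := by
    intro i j hij
    have := (sq_eq_sq₀ (by positivity) (by positivity)).mp hij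
    exact Fin.ext (by exact_mod_cast add_right_cancel this)
  have hz : (Matrix.vandermonde v).mulVec g = 0 := by
    funext i
    have h1 := congrArg (fun w : kerTheta1 (modelJet k ℓ) => (w : Fin n → ℝ) (ι i)) hsum
    simp only [Submodule.coe_sum, Submodule.coe_smul, Finset.sum_apply, Pi.smul_apply,
      kerFrame_modelJet hk _ (hι i), smul_eq_mul, Submodule.coe_zero, Pi.zero_apply] at h1
    have hne : ((i.val : ℝ) + 1) ≠ 0 := by positivity
    apply mul_left_cancel₀ hne
    rw [Pi.zero_apply, mul_zero, ← h1, Matrix.mulVec, dotProduct, Finset.mul_sum]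
    refine Finset.sum_congr rfl fun j _ => ?_
    simp only [Matrix.vandermonde_apply, v, ι, Fin.val_castLE]
    ring
  have := Matrix.eq_zero_of_mulVec_eq_zero (Matrix.det_vandermonde_ne_zero_iff.mpr hv) hz
  exact fun i => congrFun this i

end Model

/-! ### Rational functions without poles on a set of jets -/

section Rational

variable {n k : ℕ}

variable (n k) in
/-- The jets in the Euler equation with `u ≠ 0` and nondegenerate `Θ₂`. -/
def goodDomain : Set (Jet ℝ n) := {θ | θ ∈ eulerEq n k ∧ IsGoodJet k θ}

lemma goodDomain_subset : goodDomain n k ⊆ eulerEq n k := fun _ h => h.1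

lemma isGoodJet_of_mem_regularDomain {θ : Jet ℝ n} (h : θ ∈ regularDomain n k) :
    IsGoodJet k θ :=
  ⟨(mem_eulerEq.mp h.1).2, h.2.1, h.2.2.1⟩

lemma regularDomain_subset : regularDomain n k ⊆ goodDomain n k :=
  fun _ h => ⟨h.1, isGoodJet_of_mem_regularDomain h⟩

lemma linearIndependent_iff_det {K : Type*} [Field K] (M : Fin n → Fin n → K) :
    LinearIndependent K M ↔ (Matrix.of M).det ≠ 0 := by
  rw [← isUnit_iff_ne_zero, ← Matrix.isUnit_iff_isUnit_det,
    ← Matrix.linearIndependent_rows_iff_isUnit]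
  rfl

variable [NeZero n]


lemma toRat_eq_zero_iff {P : JetPoly n} : toRat n k P = 0 ↔ P ∈ eulerIdeal n k := by
  change algebraMap _ (RatFun n k) (Ideal.Quotient.mk (eulerIdeal n k) P) = 0 ↔ _
  rw [FaithfulSMul.algebraMap_eq_zero_iff, Ideal.Quotient.eq_zero_iff_mem]

lemma toRat_eq_iff {P Q : JetPoly n} :
    toRat n k P = toRat n k Q ↔ ∀ θ ∈ eulerEq n k, eval θ P = eval θ Q := by
  rw [← sub_eq_zero, ← map_sub, toRat_eq_zero_iff, Aux.mem_eulerIdeal_iff]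
  simp only [map_sub, sub_eq_zero]

lemma toRat_ne_zero {P : JetPoly n} {θ : Jet ℝ n} (hθ : θ ∈ eulerEq n k) (h : eval θ P ≠ 0) :
    toRat n k P ≠ 0 :=
  fun h0 => h (Aux.mem_eulerIdeal_iff.mp (toRat_eq_zero_iff.mp h0) θ hθ)

lemma exists_toRat_div (f : RatFun n k) :
    ∃ P Q : JetPoly n, toRat n k Q ≠ 0 ∧ f * toRat n k Q = toRat n k P := by
  obtain ⟨p, q, hq, rfl⟩ := IsFractionRing.div_surjective (A := JetPoly n ⧸ eulerIdeal n k) f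
  obtain ⟨P, rfl⟩ := Ideal.Quotient.mk_surjective p
  obtain ⟨Q, rfl⟩ := Ideal.Quotient.mk_surjective q
  have h0 : toRat n k Q ≠ 0 := by
    change algebraMap _ (RatFun n k) (Ideal.Quotient.mk (eulerIdeal n k) Q) ≠ 0
    rw [Ne, FaithfulSMul.algebraMap_eq_zero_iff]
    exact nonZeroDivisors.ne_zero hq
  exact ⟨P, Q, h0, div_mul_cancel₀ _ h0⟩

/-- The rational function `f` has no poles on `D`, and `φ` is the function that it defines there. A
single quotient of polynomials is required to serve on the whole of `D`. -/
def RatOn (D : Set (Jet ℝ n)) (f : RatFun n k) (φ : Jet ℝ n → ℝ) : Prop :=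
  ∃ P Q : JetPoly n, (∀ θ ∈ D, eval θ Q ≠ 0 ∧ φ θ = eval θ P / eval θ Q) ∧
    f * toRat n k Q = toRat n k P

namespace RatOn

variable {D D' : Set (Jet ℝ n)} {f g : RatFun n k} {φ ψ : Jet ℝ n → ℝ}

lemma toRat (P : JetPoly n) : RatOn D (HomForms.toRat n k P) fun θ => eval θ P :=
  ⟨P, 1, fun θ _ => by simp, by simp⟩

lemma coord (v : Coord n) : RatOn D (genericJet n k v) fun θ => θ v := by
  have := toRat (D := D) (k := k) (X v)
  simp only [eval_X] at this
  exact this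

lemma const (c : ℝ) : RatOn D (algebraMap ℝ (RatFun n k) c) fun _ => c := by
  simpa using toRat (D := D) (k := k) (C c)

lemma zero : RatOn D (0 : RatFun n k) fun _ => 0 := by
  simpa using const (D := D) (k := k) 0

lemma one : RatOn D (1 : RatFun n k) fun _ => 1 := by
  simpa using const (D := D) (k := k) 1

lemma natCast (m : ℕ) : RatOn D (m : RatFun n k) fun _ => m := by
  simpa using const (D := D) (k := k) m

lemma add (hf : RatOn D f φ) (hg : RatOn D g ψ) : RatOn D (f + g) fun θ => φ θ + ψ θ := by
  obtain ⟨P, Q, h, e⟩ := hf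
  obtain ⟨P', Q', h', e'⟩ := hg
  refine ⟨P * Q' + P' * Q, Q * Q', fun θ hθ => ?_, ?_⟩
  · obtain ⟨h1, h2⟩ := h θ hθ
    obtain ⟨h3, h4⟩ := h' θ hθ
    refine ⟨by simp [h1, h3], ?_⟩
    simp only [h2, h4, map_add, map_mul]
    field_simp
  · simp only [map_add, map_mul, ← e, ← e']
    ring

lemma mul (hf : RatOn D f φ) (hg : RatOn D g ψ) : RatOn D (f * g) fun θ => φ θ * ψ θ := by
  obtain ⟨P, Q, h, e⟩ := hf
  obtain ⟨P', Q', h', e'⟩ := hg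
  refine ⟨P * P', Q * Q', fun θ hθ => ?_, ?_⟩
  · obtain ⟨h1, h2⟩ := h θ hθ
    obtain ⟨h3, h4⟩ := h' θ hθ
    refine ⟨by simp [h1, h3], ?_⟩
    simp only [h2, h4, map_mul]
    field_simp
  · simp only [map_mul, ← e, ← e']
    ring

lemma sub (hf : RatOn D f φ) (hg : RatOn D g ψ) : RatOn D (f - g) fun θ => φ θ - ψ θ := by
  have := hf.add ((const (-1)).mul hg)
  simpa [sub_eq_add_neg] using this

lemma congr (hf : RatOn D f φ) (h : ∀ θ ∈ D, ψ θ = φ θ) : RatOn D f ψ := by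
  obtain ⟨P, Q, h', e⟩ := hf
  exact ⟨P, Q, fun θ hθ => ⟨(h' θ hθ).1, (h θ hθ).trans (h' θ hθ).2⟩, e⟩

lemma mono (hf : RatOn D f φ) (h : D' ⊆ D) : RatOn D' f φ := by
  obtain ⟨P, Q, h', e⟩ := hf
  exact ⟨P, Q, fun θ hθ => h' θ (h hθ), e⟩

lemma sum {ι : Type*} (s : Finset ι) {F : ι → RatFun n k} {Φ : Jet ℝ n → ι → ℝ}
    (h : ∀ i ∈ s, RatOn D (F i) fun θ => Φ θ i) :
    RatOn D (∑ i ∈ s, F i) fun θ => ∑ i ∈ s, Φ θ i := by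
  classical
  induction s using Finset.induction_on with
  | empty => simpa using zero
  | insert a s ha ih =>
    simp only [Finset.sum_insert ha]
    exact (h a (Finset.mem_insert_self a s)).add
      (ih fun i hi => h i (Finset.mem_insert_of_mem hi))

lemma prod {ι : Type*} (s : Finset ι) {F : ι → RatFun n k} {Φ : Jet ℝ n → ι → ℝ}
    (h : ∀ i ∈ s, RatOn D (F i) fun θ => Φ θ i) :
    RatOn D (∏ i ∈ s, F i) fun θ => ∏ i ∈ s, Φ θ i := by
  classical
  induction s using Finset.induction_on with
  | empty => simpa using one
  | insert a s ha ih =>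
    simp only [Finset.prod_insert ha]
    exact (h a (Finset.mem_insert_self a s)).mul
      (ih fun i hi => h i (Finset.mem_insert_of_mem hi))

lemma ne_zero (hf : RatOn D f φ) (hD : D ⊆ eulerEq n k) {θ : Jet ℝ n} (hθ : θ ∈ D)
    (h : φ θ ≠ 0) : f ≠ 0 := by
  obtain ⟨P, Q, h', e⟩ := hf
  rintro rfl
  rw [zero_mul] at e
  refine toRat_ne_zero (hD hθ) (P := P) (fun h0 => h ?_) e.symm
  rw [(h' θ hθ).2, h0, zero_div]

lemma inv (hf : RatOn D f φ) (hD : D ⊆ eulerEq n k) (hne : D.Nonempty) (h : ∀ θ ∈ D, φ θ ≠ 0) :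
    RatOn D f⁻¹ fun θ => (φ θ)⁻¹ := by
  obtain ⟨θ₀, hθ₀⟩ := hne
  have hf0 := hf.ne_zero hD hθ₀ (h θ₀ hθ₀)
  obtain ⟨P, Q, h', e⟩ := hf
  refine ⟨Q, P, fun θ hθ => ?_, ?_⟩
  · refine ⟨fun h0 => h θ hθ ?_, ?_⟩
    · rw [(h' θ hθ).2, h0, zero_div]
    · simp only [(h' θ hθ).2, inv_div]
  · rw [← e, inv_mul_cancel_left₀ hf0]

/-- A rational function is determined by its values on a Zariski dense set without poles. -/
lemma unique (hf : RatOn D f φ) (hg : RatOn D g φ) (hD : D ⊆ eulerEq n k) (hne : D.Nonempty)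
    (hdense : ∀ P : JetPoly n, (∀ θ ∈ D, eval θ P = 0) → P ∈ eulerIdeal n k) : f = g := by
  obtain ⟨θ₀, hθ₀⟩ := hne
  obtain ⟨P, Q, h, e⟩ := hf
  obtain ⟨P', Q', h', e'⟩ := hg
  have hQ := toRat_ne_zero (hD hθ₀) (h θ₀ hθ₀).1
  have hQ' := toRat_ne_zero (hD hθ₀) (h' θ₀ hθ₀).1
  have hmem : P * Q' - P' * Q ∈ eulerIdeal n k := by
    refine hdense _ fun θ hθ => ?_
    obtain ⟨h1, h2⟩ := h θ hθ
    obtain ⟨h3, h4⟩ := h' θ hθ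
    rw [h2, div_eq_div_iff h1 h3] at h4
    simp [h4]
  rw [← toRat_eq_zero_iff, map_sub, map_mul, map_mul, ← e, ← e', sub_eq_zero] at hmem
  refine mul_right_cancel₀ (mul_ne_zero hQ hQ') ?_
  linear_combination hmem

lemma theta (l : ℕ) {Y : Fin l → Fin n → RatFun n k} {y : Jet ℝ n → Fin l → Fin n → ℝ}
    (h : ∀ j i, RatOn D (Y j i) fun θ => y θ j i) :
    RatOn D (HomForms.theta (genericJet n k) l Y) fun θ => HomForms.theta θ l (y θ) := by
  simp only [HomForms.theta, applyOp_prod_dirOp]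
  have hl : RatOn D ((l.factorial : RatFun n k)⁻¹) fun _ => ((l.factorial : ℝ)⁻¹) := by
    simpa using const (D := D) (k := k) ((l.factorial : ℝ)⁻¹)
  exact hl.mul (sum _ fun m _ => (prod _ fun j _ => h j (m j)).mul (coord _))

lemma theta_two {W Y : Fin n → RatFun n k} {w y : Jet ℝ n → Fin n → ℝ}
    (hw : ∀ i, RatOn D (W i) fun θ => w θ i) (hy : ∀ i, RatOn D (Y i) fun θ => y θ i) :
    RatOn D (HomForms.theta (genericJet n k) 2 ![W, Y]) fun θ =>
      HomForms.theta θ 2 ![w θ, y θ] := by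
  refine theta 2 fun j i => ?_
  fin_cases j
  exacts [hw i, hy i]

lemma theta_three {W Y Z : Fin n → RatFun n k} {w y z : Jet ℝ n → Fin n → ℝ}
    (hw : ∀ i, RatOn D (W i) fun θ => w θ i) (hy : ∀ i, RatOn D (Y i) fun θ => y θ i)
    (hz : ∀ i, RatOn D (Z i) fun θ => z θ i) :
    RatOn D (HomForms.theta (genericJet n k) 3 ![W, Y, Z]) fun θ =>
      HomForms.theta θ 3 ![w θ, y θ, z θ] := by
  refine theta 3 fun j i => ?_
  fin_cases j
  exacts [hw i, hy i, hz i]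

lemma det {M : Matrix (Fin n) (Fin n) (RatFun n k)} {m : Jet ℝ n → Matrix (Fin n) (Fin n) ℝ}
    (h : ∀ i j, RatOn D (M i j) fun θ => m θ i j) : RatOn D M.det fun θ => (m θ).det := by
  simp only [Matrix.det_apply']
  refine sum _ fun σ _ => RatOn.mul ?_ (prod _ fun i _ => h _ _)
  simpa using const (D := D) (k := k) ((Equiv.Perm.sign σ : ℤ) : ℝ)

lemma matrix_inv {M : Matrix (Fin n) (Fin n) (RatFun n k)}
    {m : Jet ℝ n → Matrix (Fin n) (Fin n) ℝ} (hD : D ⊆ eulerEq n k) (hne : D.Nonempty)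
    (h : ∀ i j, RatOn D (M i j) fun θ => m θ i j) (hdet : ∀ θ ∈ D, (m θ).det ≠ 0) (i j : Fin n) :
    RatOn D (M⁻¹ i j) fun θ => (m θ)⁻¹ i j := by
  simp only [Matrix.inv_def, Ring.inverse_eq_inv', Matrix.smul_apply, smul_eq_mul,
    Matrix.adjugate_apply]
  refine ((det h).inv hD hne hdet).mul (det fun a b => ?_)
  simp only [Matrix.updateRow_apply, Pi.single_apply]
  split_ifs
  exacts [one, zero, h a b]

lemma mulVec {M : Matrix (Fin n) (Fin n) (RatFun n k)} {m : Jet ℝ n → Matrix (Fin n) (Fin n) ℝ}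
    {Y : Fin n → RatFun n k} {y : Jet ℝ n → Fin n → ℝ}
    (h : ∀ i j, RatOn D (M i j) fun θ => m θ i j) (hy : ∀ i, RatOn D (Y i) fun θ => y θ i)
    (i : Fin n) : RatOn D (M.mulVec Y i) fun θ => (m θ).mulVec (y θ) i :=
  sum Finset.univ fun j _ => (h i j).mul (hy j)

lemma single (a i : Fin n) :
    RatOn D ((Pi.single a 1 : Fin n → RatFun n k) i) fun _ => (Pi.single a 1 : Fin n → ℝ) i := by
  simp only [Pi.single_apply]
  split_ifs
  exacts [one, zero]

lemma gram (i j : Fin n) :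
    RatOn D (HomForms.gram (genericJet n k) i j) fun θ => HomForms.gram θ i j :=
  theta_two (fun _ => single _ _) (fun _ => single _ _)

lemma projVec (hk : 3 ≤ k) (hD : D ⊆ eulerEq n k) (hne : D.Nonempty)
    (hu : ∀ θ ∈ D, θ (Sum.inr 0) ≠ 0) (a i : Fin n) :
    RatOn D (HomForms.projVec k (genericJet n k) (Pi.single a 1) i)
      fun θ => HomForms.projVec k θ (Pi.single a 1) i := by
  have hk0 : (k : ℝ) ≠ 0 := by exact_mod_cast (show k ≠ 0 by omega)
  simp only [projVec_apply, applyOp_dirOp, Pi.sub_apply, Pi.smul_apply, smul_eq_mul]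
  exact (single a i).sub (((sum Finset.univ fun j _ => (single a j).mul (coord _)).mul
    (((natCast k).mul (coord _)).inv hD hne fun θ hθ => mul_ne_zero hk0 (hu θ hθ))).mul (coord _))

end RatOn

/-! ### The frame and its coefficients as rational functions -/

lemma regularDomain_nonempty (hk : 3 ≤ k) : (regularDomain n k).Nonempty := by
  have hn := Nat.pos_of_ne_zero (NeZero.ne n)
  refine ⟨modelJet k (⟨n - 1, by omega⟩ : Fin n),
    mem_eulerEq.mpr ⟨⟨⟨n - 1, by omega⟩, by simp [modelJet]⟩, isEulerJet_modelJet hk _⟩,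
    isRegularJet_modelJet hk ?_⟩
  simp only
  omega

lemma goodDomain_nonempty (hk : 3 ≤ k) : (goodDomain n k).Nonempty :=
  (regularDomain_nonempty hk).mono regularDomain_subset

/-- The tautological jet satisfies the Euler equation over the field of rational functions. -/
lemma isEulerJet_genericJet : IsEulerJet k (genericJet n k) where
  euler α hα := by
    have : toRat n k (∑ i, X (Sum.inl i) * X (Sum.inr (α + oneAt i))) =
        toRat n k (C ((k : ℝ) - α.degree) * X (Sum.inr α)) := by
      rw [toRat_eq_iff]
      intro θ hθ
      simpa using hθ.2.1 α hα
    simpa [genericJet] using this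
  zero β hβ := by
    refine toRat_eq_zero_iff.mpr (Aux.mem_eulerIdeal_iff.mpr fun θ hθ => ?_)
    rw [eval_X]
    exact hθ.2.2 β hβ

instance : CharZero (RatFun n k) := algebraRat.charZero _

lemma isGoodJet_genericJet (hk : 3 ≤ k) : IsGoodJet k (genericJet n k) where
  toIsEulerJet := isEulerJet_genericJet
  u_ne_zero := by
    obtain ⟨θ, hθ⟩ := goodDomain_nonempty (n := n) hk
    exact (RatOn.coord _).ne_zero goodDomain_subset hθ hθ.2.u_ne_zero
  nondegenerate := by
    obtain ⟨θ, hθ⟩ := goodDomain_nonempty (n := n) hk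
    rw [nondegenerate_theta2_iff_det]
    exact (RatOn.det RatOn.gram).ne_zero goodDomain_subset hθ
      (nondegenerate_theta2_iff_det.mp hθ.2.nondegenerate)

lemma ratOn_gram_inv (hk : 3 ≤ k) (i j : Fin n) :
    RatOn (goodDomain n k) ((gram (genericJet n k))⁻¹ i j) fun θ => (gram θ)⁻¹ i j :=
  RatOn.matrix_inv goodDomain_subset (goodDomain_nonempty hk) RatOn.gram
    (fun _ hθ => nondegenerate_theta2_iff_det.mp hθ.2.nondegenerate) i j

lemma ratOn_projVec (hk : 3 ≤ k) (a i : Fin n) :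
    RatOn (goodDomain n k) (projVec k (genericJet n k) (Pi.single a 1) i)
      fun θ => projVec k θ (Pi.single a 1) i :=
  RatOn.projVec hk goodDomain_subset (goodDomain_nonempty hk) (fun _ hθ => hθ.2.u_ne_zero) a i

lemma ratOn_lamHat (hk : 3 ≤ k) (i : Fin n) :
    RatOn (goodDomain n k) ((lamHat (genericJet n k) : Fin n → RatFun n k) i)
      fun θ => (lamHat θ : Fin n → ℝ) i := by
  rw [(isGoodJet_genericJet hk).coe_lamHat hk]
  refine RatOn.congr ?_ fun θ hθ => congrFun (hθ.2.coe_lamHat hk) i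
  exact RatOn.mulVec (ratOn_gram_inv hk) (fun a => RatOn.sum _ fun c _ =>
    RatOn.mulVec (ratOn_gram_inv hk) (fun b => RatOn.theta_three (ratOn_projVec hk a)
      (ratOn_projVec hk c) (ratOn_projVec hk b)) c) i

lemma ratOn_kerFrame (hk : 3 ≤ k) (a : ℕ) (i : Fin n) :
    RatOn (goodDomain n k) ((kerFrame (genericJet n k) a : Fin n → RatFun n k) i)
      fun θ => (kerFrame θ a : Fin n → ℝ) i := by
  induction a generalizing i with
  | zero => exact ratOn_lamHat hk i
  | succ a ih =>
    rw [(isGoodJet_genericJet hk).coe_kerFrame_succ hk]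
    refine RatOn.congr ?_ fun θ hθ => congrFun (hθ.2.coe_kerFrame_succ hk a) i
    exact RatOn.mulVec (ratOn_gram_inv hk) (fun b => RatOn.theta_three (ratOn_lamHat hk) ih
      (ratOn_projVec hk b)) i

lemma ratOn_frame (hk : 3 ≤ k) (a i : Fin n) :
    RatOn (goodDomain n k) (frame (genericJet n k) a i) fun θ => frame θ a i := by
  unfold frame
  split_ifs
  exacts [ratOn_kerFrame hk a i, RatOn.coord _]

lemma ratOn_thetaCoeff (hk : 3 ≤ k) (l : ℕ) (a : Fin l → Fin (n - 1)) :
    RatOn (goodDomain n k) (thetaCoeff (genericJet n k) l a) fun θ => thetaCoeff θ l a :=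
  RatOn.theta l fun j i => ratOn_kerFrame hk (a j) i

lemma linearIndependent_frame {θ : Jet ℝ n} (hk : 3 ≤ k) (h : θ ∈ regularDomain n k) :
    LinearIndependent ℝ (frame θ) :=
  ((isGoodJet_of_mem_regularDomain h).linearIndependent_frame_iff hk
    (Nat.pos_of_ne_zero (NeZero.ne n))).mpr h.2.2.2

lemma ratOn_det_frame (hk : 3 ≤ k) :
    RatOn (goodDomain n k) (frameMatrix n k).det fun θ => (Matrix.of (frame θ)).det :=
  RatOn.det (ratOn_frame hk)

lemma det_frameMatrix_ne_zero (hk : 3 ≤ k) : (frameMatrix n k).det ≠ 0 := by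
  obtain ⟨θ, hθ⟩ := regularDomain_nonempty (n := n) hk
  exact (ratOn_det_frame hk).ne_zero goodDomain_subset (regularDomain_subset hθ)
    ((linearIndependent_iff_det _).mp (linearIndependent_frame hk hθ))

/-- The regular jets are the nonzeros of a polynomial function on the Euler equation. -/
lemma regularDomain_dense (hk : 3 ≤ k) (P : JetPoly n)
    (hP : ∀ θ ∈ regularDomain n k, eval θ P = 0) : P ∈ eulerIdeal n k := by
  -- `A` and `B` are the numerator and the denominator of the determinant of the frame.
  obtain ⟨A, B, hAB, -⟩ := ratOn_det_frame (n := n) hk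
  beta_reduce at hAB
  obtain ⟨G, hG⟩ : ∃ G : JetPoly n, ∀ θ : Jet ℝ n, eval θ G = (gram θ).det := by
    refine ⟨(Matrix.of fun i j => C (1 / 2) * X (Sum.inr (oneAt i + oneAt j)) :
      Matrix (Fin n) (Fin n) (JetPoly n)).det, fun θ => ?_⟩
    rw [RingHom.map_det]
    congr 1
    ext i j
    rw [gram, Matrix.of_apply, theta_two_single]
    simp
    ring
  -- A jet where `u`, `det Θ₂` and `A` do not vanish is regular.
  have hmem : P * (X (Sum.inr 0) * G * A) ∈ eulerIdeal n k := by
    refine Aux.mem_eulerIdeal_iff.mpr fun θ hθ => ?_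
    simp only [map_mul, eval_X, hG]
    by_contra h0
    simp only [mul_eq_zero, not_or] at h0
    obtain ⟨h1, ⟨h2, h3⟩, h4⟩ := h0
    have hg : IsGoodJet k θ := ⟨(mem_eulerEq.mp hθ).2, h2, nondegenerate_theta2_iff_det.mpr h3⟩
    refine h1 (hP θ ⟨hθ, h2, hg.nondegenerate, ?_⟩)
    rw [← hg.linearIndependent_frame_iff hk (Nat.pos_of_ne_zero (NeZero.ne n)),
      linearIndependent_iff_det, (hAB θ ⟨hθ, hg⟩).2]
    exact div_ne_zero h4 (hAB θ ⟨hθ, hg⟩).1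
  refine ((eulerIdeal_isPrime n k).mem_or_mem hmem).resolve_right fun h => ?_
  obtain ⟨θ, hθ⟩ := regularDomain_nonempty (n := n) hk
  have h0 := Aux.mem_eulerIdeal_iff.mp h θ hθ.1
  simp only [map_mul, eval_X, hG] at h0
  have hA := (linearIndependent_iff_det _).mp (linearIndependent_frame hk hθ)
  rw [(hAB θ (regularDomain_subset hθ)).2] at hA
  exact mul_ne_zero (mul_ne_zero hθ.2.1 (nondegenerate_theta2_iff_det.mp hθ.2.2.1))
    (fun h => hA (by rw [h, zero_div])) h0

lemma RatOn.unique_of_regular {f g : RatFun n k} {φ : Jet ℝ n → ℝ} (hk : 3 ≤ k)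
    (hf : RatOn (regularDomain n k) f φ) (hg : RatOn (regularDomain n k) g φ) : f = g :=
  hf.unique hg (fun _ h => h.1) (regularDomain_nonempty hk) (regularDomain_dense hk)

end Rational

/-! ### The prolonged action -/

section Action

variable {n k : ℕ}

/-- The effect of the prolonged action of `A` on operators with constant coefficients: the linear
substitution `∂_i ↦ ∑_j (A⁻¹)_{ji} ∂_j`. -/
def opSubst (A : GL (Fin n) ℝ) : MvPolynomial (Fin n) ℝ →ₐ[ℝ] MvPolynomial (Fin n) ℝ :=
  aeval fun i => dirOp fun j => ((A⁻¹ : GL (Fin n) ℝ) : Matrix (Fin n) (Fin n) ℝ) j i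

lemma opSubst_X (A : GL (Fin n) ℝ) (i : Fin n) : opSubst A (X i) =
    dirOp fun j => ((A⁻¹ : GL (Fin n) ℝ) : Matrix (Fin n) (Fin n) ℝ) j i :=
  aeval_X _ _

lemma opSubst_monomial (A : GL (Fin n) ℝ) (α : Fin n →₀ ℕ) : opSubst A (monomial α 1) =
    ∏ i, dirOp (fun j => ((A⁻¹ : GL (Fin n) ℝ) : Matrix (Fin n) (Fin n) ℝ) j i) ^ α i := by
  rw [opSubst, aeval_monomial, map_one, one_mul, Finsupp.prod_fintype _ _ fun _ => pow_zero _]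

lemma opSubst_dirOp (A : GL (Fin n) ℝ) (Y : Fin n → ℝ) : opSubst A (dirOp Y) =
    dirOp (((A⁻¹ : GL (Fin n) ℝ) : Matrix (Fin n) (Fin n) ℝ).mulVec Y) := by
  rw [dirOp_apply, map_sum]
  simp only [map_smul, opSubst_X]
  simp only [← map_smul]
  rw [← map_sum]
  congr 1
  ext j
  simp [Matrix.mulVec, dotProduct, mul_comm]

lemma inv_mulVec_mulVec (A : GL (Fin n) ℝ) (Y : Fin n → ℝ) :
    ((A⁻¹ : GL (Fin n) ℝ) : Matrix (Fin n) (Fin n) ℝ).mulVec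
      ((A : Matrix (Fin n) (Fin n) ℝ).mulVec Y) = Y := by
  rw [Matrix.mulVec_mulVec, ← Units.val_mul, inv_mul_cancel, Units.val_one, Matrix.one_mulVec]

lemma mulVec_inv_mulVec (A : GL (Fin n) ℝ) (Y : Fin n → ℝ) :
    (A : Matrix (Fin n) (Fin n) ℝ).mulVec
      (((A⁻¹ : GL (Fin n) ℝ) : Matrix (Fin n) (Fin n) ℝ).mulVec Y) = Y := by
  rw [Matrix.mulVec_mulVec, ← Units.val_mul, mul_inv_cancel, Units.val_one, Matrix.one_mulVec]

lemma opSubst_dirOp_mulVec (A : GL (Fin n) ℝ) (Y : Fin n → ℝ) :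
    opSubst A (dirOp ((A : Matrix (Fin n) (Fin n) ℝ).mulVec Y)) = dirOp Y := by
  rw [opSubst_dirOp, inv_mulVec_mulVec]

lemma isHomogeneous_opSubst (A : GL (Fin n) ℝ) {p : MvPolynomial (Fin n) ℝ} {d : ℕ}
    (hp : p.IsHomogeneous d) : (opSubst A p).IsHomogeneous d := by
  have := hp.aeval _ fun i => isHomogeneous_dirOp (fun j =>
    ((A⁻¹ : GL (Fin n) ℝ) : Matrix (Fin n) (Fin n) ℝ) j i)
  rwa [one_mul] at this

lemma opSubst_mul (A B : GL (Fin n) ℝ) (p : MvPolynomial (Fin n) ℝ) :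
    opSubst (A * B) p = opSubst B (opSubst A p) := by
  have : opSubst (A * B) = (opSubst B).comp (opSubst A) := by
    ext1 i
    rw [AlgHom.comp_apply, opSubst_X, opSubst_X, opSubst_dirOp, mul_inv_rev, Units.val_mul]
    rfl
  rw [this, AlgHom.comp_apply]

lemma act_inl (A : GL (Fin n) ℝ) (θ : Jet ℝ n) (i : Fin n) :
    act A θ (Sum.inl i) = (A : Matrix (Fin n) (Fin n) ℝ).mulVec (rad θ) i := rfl

lemma rad_act (A : GL (Fin n) ℝ) (θ : Jet ℝ n) :
    rad (act A θ) = (A : Matrix (Fin n) (Fin n) ℝ).mulVec (rad θ) := rfl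

lemma applyOp_act (A : GL (Fin n) ℝ) (θ : Jet ℝ n) (p : MvPolynomial (Fin n) ℝ) :
    applyOp (act A θ) p = applyOp θ (opSubst A p) := by
  have : applyOp (act A θ) = applyOp θ ∘ₗ (opSubst A).toLinearMap := by
    refine (basisMonomials (Fin n) ℝ).ext fun α => ?_
    simp only [coe_basisMonomials, LinearMap.comp_apply, AlgHom.toLinearMap_apply,
      opSubst_monomial, applyOp_monomial, one_mul]
    rfl
  rw [this, LinearMap.comp_apply, AlgHom.toLinearMap_apply]

lemma act_mul (A B : GL (Fin n) ℝ) (θ : Jet ℝ n) : act (A * B) θ = act A (act B θ) := by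
  funext v
  rcases v with i | α
  · rw [act_inl, act_inl, rad_act, Matrix.mulVec_mulVec, Units.val_mul]
  · rw [← one_mul (act (A * B) θ _), ← applyOp_monomial, ← one_mul (act A (act B θ) _),
      ← applyOp_monomial, applyOp_act, applyOp_act, applyOp_act, opSubst_mul]

lemma act_one (θ : Jet ℝ n) : act 1 θ = θ := by
  have h1 : opSubst (1 : GL (Fin n) ℝ) = AlgHom.id ℝ _ := by
    ext1 i
    rw [opSubst_X, AlgHom.id_apply, ← dirOp_single]
    congr 1
    ext j
    simp [Matrix.one_apply, Pi.single_apply]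
  funext v
  rcases v with i | α
  · rw [act_inl, Units.val_one, Matrix.one_mulVec, rad]
  · rw [← one_mul (act 1 θ _), ← applyOp_monomial, applyOp_act, h1, AlgHom.id_apply,
      applyOp_monomial, one_mul]

lemma theta_act (A : GL (Fin n) ℝ) (θ : Jet ℝ n) (l : ℕ) (Y : Fin l → Fin n → ℝ) :
    theta (act A θ) l (fun j => (A : Matrix (Fin n) (Fin n) ℝ).mulVec (Y j)) = theta θ l Y := by
  simp only [theta, applyOp_act, map_prod, opSubst_dirOp_mulVec]

/-- The linear isomorphism given by an element of the general linear group. -/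
def glEquiv (A : GL (Fin n) ℝ) : (Fin n → ℝ) ≃ₗ[ℝ] (Fin n → ℝ) :=
  LinearEquiv.ofLinearMap (Matrix.mulVecLin (A : Matrix (Fin n) (Fin n) ℝ))
    (Matrix.mulVecLin ((A⁻¹ : GL (Fin n) ℝ) : Matrix (Fin n) (Fin n) ℝ))
    (LinearMap.ext (mulVec_inv_mulVec A)) (LinearMap.ext (inv_mulVec_mulVec A))

lemma glEquiv_apply (A : GL (Fin n) ℝ) (Y : Fin n → ℝ) :
    glEquiv A Y = (A : Matrix (Fin n) (Fin n) ℝ).mulVec Y := rfl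

lemma carries_act (A : GL (Fin n) ℝ) (θ : Jet ℝ n) : Carries θ (act A θ) (glEquiv A) :=
  fun l _ Y => theta_act A θ l Y

lemma frame_act (A : GL (Fin n) ℝ) (θ : Jet ℝ n) (a : Fin n) :
    frame (act A θ) a = (A : Matrix (Fin n) (Fin n) ℝ).mulVec (frame θ a) := by
  unfold frame
  split_ifs
  · rw [(carries_act A θ).coe_kerFrame, glEquiv_apply]
  · exact rad_act A θ

lemma thetaCoeff_act (A : GL (Fin n) ℝ) (θ : Jet ℝ n) (l : ℕ) (a : Fin l → Fin (n - 1)) :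
    thetaCoeff (act A θ) l a = thetaCoeff θ l a := by
  rw [thetaCoeff, thetaCoeff, ← theta_act A θ]
  simp only [(carries_act A θ).coe_kerFrame, glEquiv_apply]

lemma act_mem_eulerEq (A : GL (Fin n) ℝ) {θ : Jet ℝ n} (h : θ ∈ eulerEq n k) :
    act A θ ∈ eulerEq n k := by
  obtain ⟨⟨i, hi⟩, he⟩ := mem_eulerEq.mp h
  refine mem_eulerEq.mpr ⟨?_, ?_, ?_⟩
  · by_contra! h0
    have h1 : (A : Matrix (Fin n) (Fin n) ℝ).mulVec (rad θ) = 0 := funext h0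
    have h2 := inv_mulVec_mulVec A (rad θ)
    rw [h1, Matrix.mulVec_zero] at h2
    exact hi (congrFun h2.symm i)
  · intro α hα
    have h1 := he.applyOp_dirOp_rad_mul
      (isHomogeneous_opSubst A (isHomogeneous_monomial (1 : ℝ) (rfl : α.degree = α.degree))) hα
    rw [← opSubst_dirOp_mulVec A, ← map_mul, ← applyOp_act, ← applyOp_act, ← rad_act,
      applyOp_monomial, one_mul, dirOp_apply, Finset.sum_mul, map_sum] at h1
    simpa only [smul_mul_assoc, map_smul, applyOp_monomial_X_mul, smul_eq_mul, one_mul, rad]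
      using h1
  · intro β hβ
    rw [← one_mul (act A θ _), ← applyOp_monomial, applyOp_act]
    exact he.applyOp_eq_zero (isHomogeneous_opSubst A (isHomogeneous_monomial (1 : ℝ) rfl)) hβ

lemma act_mem_regularDomain (A : GL (Fin n) ℝ) {θ : Jet ℝ n} (h : θ ∈ regularDomain n k) :
    act A θ ∈ regularDomain n k :=
  ⟨act_mem_eulerEq A h.1, (carries_act A θ).isRegularJet_iff.mpr h.2⟩

/-! ### The action on polynomial functions -/

/-- The operator `∑ c_α ∂^α`, applied to the function with the tautological jet: `∑ c_α u_α`. -/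
def univOp : MvPolynomial (Fin n) ℝ →ₗ[ℝ] JetPoly n :=
  (basisMonomials (Fin n) ℝ).constr ℝ fun α => X (Sum.inr α)

lemma univOp_monomial (α : Fin n →₀ ℕ) :
    univOp (monomial α 1) = (X (Sum.inr α) : JetPoly n) := by
  have : monomial α 1 = basisMonomials (Fin n) ℝ α := by simp
  rw [this, univOp, Module.Basis.constr_basis]

lemma eval_univOp (θ : Jet ℝ n) (p : MvPolynomial (Fin n) ℝ) :
    eval θ (univOp p) = applyOp θ p := by
  have : (aeval θ : JetPoly n →ₐ[ℝ] ℝ).toLinearMap ∘ₗ univOp = applyOp θ := by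
    refine (basisMonomials (Fin n) ℝ).ext fun α => ?_
    simp only [coe_basisMonomials, LinearMap.comp_apply, AlgHom.toLinearMap_apply,
      univOp_monomial, applyOp_monomial, one_mul, aeval_X]
  rw [← this, LinearMap.comp_apply, AlgHom.toLinearMap_apply, aeval_eq_eval]

lemma totalDerivPoly_univOp (i : Fin n) (p : MvPolynomial (Fin n) ℝ) :
    totalDerivPoly i (univOp p) = univOp (X i * p) := by
  have : (totalDerivPoly i : JetPoly n →ₗ[ℝ] JetPoly n) ∘ₗ univOp =
      univOp ∘ₗ LinearMap.mulLeft ℝ (X i) := by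
    refine (basisMonomials (Fin n) ℝ).ext fun α => ?_
    simp only [coe_basisMonomials, LinearMap.comp_apply, univOp_monomial,
      LinearMap.mulLeft_apply, Derivation.coeFn_coe]
    rw [totalDerivPoly, mkDerivation_X, totalDerivCoord, mul_comm, X, X, monomial_mul, mul_one,
      univOp_monomial]
    rfl
  exact congrArg (fun f => f p) this

/-- The pull-back `P ↦ P ∘ A` of polynomial functions under the prolonged action. -/
def pullPoly (A : GL (Fin n) ℝ) : JetPoly n →ₐ[ℝ] JetPoly n :=
  aeval (Sum.elim
    (fun i => ∑ j, C ((A : Matrix (Fin n) (Fin n) ℝ) i j) * X (Sum.inl j))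
    (fun α => univOp (opSubst A (monomial α 1))))

lemma pullPoly_inl (A : GL (Fin n) ℝ) (i : Fin n) : pullPoly A (X (Sum.inl i)) =
    ∑ j, C ((A : Matrix (Fin n) (Fin n) ℝ) i j) * X (Sum.inl j) :=
  aeval_X _ _

lemma pullPoly_inr (A : GL (Fin n) ℝ) (α : Fin n →₀ ℕ) : pullPoly A (X (Sum.inr α)) =
    univOp (opSubst A (monomial α 1)) :=
  aeval_X _ _

lemma eval_pullPoly (A : GL (Fin n) ℝ) (θ : Jet ℝ n) (P : JetPoly n) :
    eval θ (pullPoly A P) = eval (act A θ) P := by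
  induction P using MvPolynomial.induction_on with
  | C a => simp [pullPoly]
  | add p q hp hq => simp [hp, hq]
  | mul_X p v hp =>
    rw [map_mul, map_mul, map_mul, hp, eval_X]
    congr 1
    rcases v with i | α
    · rw [pullPoly_inl, act_inl]
      simp [Matrix.mulVec, dotProduct, rad]
    · rw [pullPoly_inr, eval_univOp, ← applyOp_act, applyOp_monomial, one_mul]

lemma pullPoly_mem_iff (A : GL (Fin n) ℝ) (P : JetPoly n) :
    pullPoly A P ∈ eulerIdeal n k ↔ P ∈ eulerIdeal n k := by
  simp only [Aux.mem_eulerIdeal_iff, eval_pullPoly]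
  refine ⟨fun h θ hθ => ?_, fun h θ hθ => h _ (act_mem_eulerEq A hθ)⟩
  have := h _ (act_mem_eulerEq A⁻¹ hθ)
  rwa [← act_mul, mul_inv_cancel, act_one] at this

/-- Total derivatives transform under the action like the partial derivatives on the base. -/
lemma pullPoly_totalDerivPoly (A : GL (Fin n) ℝ) (i : Fin n) (P : JetPoly n) :
    pullPoly A (totalDerivPoly i P) =
      ∑ j, ((A⁻¹ : GL (Fin n) ℝ) : Matrix (Fin n) (Fin n) ℝ) j i •
        totalDerivPoly j (pullPoly A P) := by
  induction P using MvPolynomial.induction_on with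
  | C a =>
    have hC : ∀ j : Fin n, totalDerivPoly j (C a) = 0 :=
      fun j => (totalDerivPoly j).map_algebraMap a
    have hp : pullPoly A (C a) = C a := algHom_C _ _
    simp [hC, hp]
  | add p q hp hq => simp only [map_add, hp, hq, smul_add, Finset.sum_add_distrib]
  | mul_X p v hp =>
    have hv : pullPoly A (totalDerivPoly i (X v)) =
        ∑ j, ((A⁻¹ : GL (Fin n) ℝ) : Matrix (Fin n) (Fin n) ℝ) j i •
          totalDerivPoly j (pullPoly A (X v)) := by
      rcases v with l | α
      · have h1 : ∀ j, totalDerivPoly j (pullPoly A (X (Sum.inl l))) =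
            C ((A : Matrix (Fin n) (Fin n) ℝ) l j) := by
          intro j
          rw [pullPoly_inl, map_sum, Finset.sum_eq_single j]
          · rw [← smul_eq_C_mul, Derivation.map_smul, totalDerivPoly, mkDerivation_X]
            simp [totalDerivCoord, smul_eq_C_mul]
          · intro m _ hm
            rw [← smul_eq_C_mul, Derivation.map_smul, totalDerivPoly, mkDerivation_X]
            simp [totalDerivCoord, hm]
          · simp
        have h2 : ∑ j, ((A⁻¹ : GL (Fin n) ℝ) : Matrix (Fin n) (Fin n) ℝ) j i *
            (A : Matrix (Fin n) (Fin n) ℝ) l j = if l = i then 1 else 0 := by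
          have : ((A * A⁻¹ : GL (Fin n) ℝ) : Matrix (Fin n) (Fin n) ℝ) l i =
              if l = i then 1 else 0 := by
            rw [mul_inv_cancel, Units.val_one, Matrix.one_apply]
          rw [← this, Units.val_mul, Matrix.mul_apply]
          exact Finset.sum_congr rfl fun j _ => mul_comm _ _
        simp only [h1, smul_eq_C_mul, ← C_mul]
        rw [← map_sum, h2, totalDerivPoly, mkDerivation_X, totalDerivCoord]
        split_ifs <;> simp
      · have h1 : pullPoly A (totalDerivPoly i (X (Sum.inr α))) =
            univOp (opSubst A (X i) * opSubst A (monomial α 1)) := by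
          rw [totalDerivPoly, mkDerivation_X, totalDerivCoord, pullPoly_inr, ← map_mul, mul_comm,
            X, monomial_mul, mul_one]
        rw [h1, opSubst_X, dirOp_apply, Finset.sum_mul, map_sum]
        refine Finset.sum_congr rfl fun j _ => ?_
        rw [pullPoly_inr, totalDerivPoly_univOp, smul_mul_assoc, map_smul]
    simp only [Derivation.leibniz, map_add, smul_eq_mul, map_mul, hp, hv, smul_add,
      Finset.sum_add_distrib, Finset.mul_sum, mul_smul_comm]

end Action

/-! ### The action on rational functions -/

section Pull

variable {n k : ℕ} [NeZero n]

/-- The pull-back under the prolonged action, from the coordinate ring of the Euler equation to its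
fraction field. -/
def pullQuot (k : ℕ) (A : GL (Fin n) ℝ) : (JetPoly n ⧸ eulerIdeal n k) →ₐ[ℝ] RatFun n k :=
  Ideal.Quotient.liftₐ (eulerIdeal n k) ((toRat n k).comp (pullPoly A))
    fun P hP => toRat_eq_zero_iff.mpr ((pullPoly_mem_iff A P).mpr hP)

lemma pullQuot_injective (A : GL (Fin n) ℝ) : Function.Injective (pullQuot k A) := by
  rw [injective_iff_map_eq_zero]
  intro p hp
  obtain ⟨P, rfl⟩ := Ideal.Quotient.mk_surjective p
  rw [Ideal.Quotient.eq_zero_iff_mem, ← pullPoly_mem_iff A, ← toRat_eq_zero_iff]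
  exact hp

/-- The pull-back `f ↦ f ∘ A` of rational functions on the Euler equation under the prolonged
action. -/
def pull (k : ℕ) (A : GL (Fin n) ℝ) : RatFun n k →ₐ[ℝ] RatFun n k :=
  IsFractionRing.liftAlgHom (pullQuot_injective A)

lemma pull_toRat (A : GL (Fin n) ℝ) (P : JetPoly n) :
    pull k A (toRat n k P) = toRat n k (pullPoly A P) :=
  IsFractionRing.lift_algebraMap (pullQuot_injective (k := k) A)
    (Ideal.Quotient.mk (eulerIdeal n k) P)

/-- Invariance of the values, wherever they are defined, is invariance as an element of the field of
rational functions, since the Euler equation is irreducible. -/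
lemma isInvariant_iff_pull {f : RatFun n k} :
    IsInvariant f ↔ ∀ A : GL (Fin n) ℝ, pull k A f = f := by
  refine ⟨fun hf A => ?_, fun hf A θ hθ c c' h h' => ?_⟩
  · obtain ⟨P, Q, hQ, e⟩ := exists_toRat_div f
    have hQ' : toRat n k (pullPoly A Q) ≠ 0 := by
      rwa [Ne, toRat_eq_zero_iff, pullPoly_mem_iff, ← toRat_eq_zero_iff]
    have e' : pull k A f * toRat n k (pullPoly A Q) = toRat n k (pullPoly A P) := by
      rw [← pull_toRat, ← pull_toRat, ← map_mul, e]
    -- The factors `Q` and `Q ∘ A` take care of the jets where a value is undefined.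
    have key : toRat n k ((P * pullPoly A Q - pullPoly A P * Q) * (Q * pullPoly A Q)) = 0 := by
      refine toRat_eq_zero_iff.mpr (Aux.mem_eulerIdeal_iff.mpr fun θ hθ => ?_)
      simp only [map_mul, map_sub, eval_pullPoly]
      by_cases h1 : eval θ Q = 0
      · simp [h1]
      by_cases h2 : eval (act A θ) Q = 0
      · simp [h2]
      have := hf A θ hθ _ _ ⟨P, Q, h1, e, rfl⟩ ⟨P, Q, h2, e, rfl⟩
      rw [div_eq_div_iff h1 h2] at this
      rw [this, sub_self, zero_mul]
    rw [map_mul, map_mul, mul_eq_zero, or_iff_left (mul_ne_zero hQ hQ'), map_sub, map_mul, map_mul,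
      ← e, ← e', sub_eq_zero] at key
    refine mul_right_cancel₀ (mul_ne_zero hQ hQ') ?_
    linear_combination -key
  · obtain ⟨P, Q, h1, e, rfl⟩ := h
    obtain ⟨P', Q', h1', e', rfl⟩ := h'
    have h2 := congrArg (pull k A) e'
    rw [map_mul, hf A, pull_toRat, pull_toRat] at h2
    have h3 : toRat n k (P * pullPoly A Q') = toRat n k (pullPoly A P' * Q) := by
      rw [map_mul, map_mul, ← e, ← h2]
      ring
    have h4 := toRat_eq_iff.mp h3 θ hθ
    rw [map_mul, map_mul, eval_pullPoly, eval_pullPoly] at h4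
    rw [div_eq_div_iff h1 h1', h4]

lemma RatOn.pull {D : Set (Jet ℝ n)} {f : RatFun n k} {φ : Jet ℝ n → ℝ} (hf : RatOn D f φ)
    (A : GL (Fin n) ℝ) (hD : ∀ θ ∈ D, act A θ ∈ D) :
    RatOn D (HomForms.pull k A f) fun θ => φ (act A θ) := by
  obtain ⟨P, Q, h, e⟩ := hf
  refine ⟨pullPoly A P, pullPoly A Q, fun θ hθ => ?_, ?_⟩
  · rw [eval_pullPoly, eval_pullPoly]
    exact h _ (hD θ hθ)
  · rw [← pull_toRat, ← pull_toRat, ← map_mul, e]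

variable (n k) in
/-- The field of rational differential invariants. -/
def invariantField : IntermediateField ℝ (RatFun n k) where
  carrier := {f | IsInvariant f}
  mul_mem' {f g} hf hg := by
    simp only [Set.mem_ofPred_eq, isInvariant_iff_pull] at *
    exact fun A => by rw [map_mul, hf, hg]
  add_mem' {f g} hf hg := by
    simp only [Set.mem_ofPred_eq, isInvariant_iff_pull] at *
    exact fun A => by rw [map_add, hf, hg]
  algebraMap_mem' c := isInvariant_iff_pull.mpr fun A => AlgHom.commutes _ c
  inv_mem' f hf := by
    simp only [Set.mem_ofPred_eq, isInvariant_iff_pull] at *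
    exact fun A => by rw [map_inv₀, hf]

lemma pull_eq_self {f : RatFun n k} (hf : f ∈ invariantField n k) (A : GL (Fin n) ℝ) :
    pull k A f = f :=
  isInvariant_iff_pull.mp hf A

/-- A rational function whose values on the regular domain are invariant is invariant. -/
lemma mem_invariantField_of_ratOn (hk : 3 ≤ k) {f : RatFun n k} {φ : Jet ℝ n → ℝ}
    (hf : RatOn (regularDomain n k) f φ)
    (h : ∀ (A : GL (Fin n) ℝ), ∀ θ ∈ regularDomain n k, φ (act A θ) = φ θ) :
    f ∈ invariantField n k :=
  isInvariant_iff_pull.mpr fun A => RatOn.unique_of_regular hk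
    ((hf.pull A fun _ => act_mem_regularDomain A).congr fun θ hθ => (h A θ hθ).symm) hf

lemma u_mem_invariantField (hk : 3 ≤ k) :
    genericJet n k (Sum.inr 0) ∈ invariantField n k :=
  mem_invariantField_of_ratOn hk (RatOn.coord _) fun A θ _ => (carries_act A θ).map_zero

lemma thetaCoeff_mem_invariantField (hk : 3 ≤ k) (l : ℕ) (a : Fin l → Fin (n - 1)) :
    thetaCoeff (genericJet n k) l a ∈ invariantField n k :=
  mem_invariantField_of_ratOn hk ((ratOn_thetaCoeff hk l a).mono regularDomain_subset)
    fun A θ _ => thetaCoeff_act A θ l a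

/-- The frame is equivariant as a frame of rational vector fields. -/
lemma pull_frame (hk : 3 ≤ k) (A : GL (Fin n) ℝ) (a i : Fin n) :
    pull k A (frame (genericJet n k) a i) =
      ∑ j, algebraMap ℝ _ ((A : Matrix (Fin n) (Fin n) ℝ) i j) * frame (genericJet n k) a j := by
  have hf := fun i => (ratOn_frame (n := n) hk a i).mono regularDomain_subset
  refine ((hf i).pull A fun _ => act_mem_regularDomain A).unique_of_regular hk
    ((RatOn.sum Finset.univ fun j _ => (RatOn.const _).mul (hf j)).congr fun θ _ => ?_)
  rw [frame_act]
  rfl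

lemma pull_totalDeriv (A : GL (Fin n) ℝ) (i : Fin n) (f : RatFun n k) :
    pull k A (totalDeriv i f) =
      ∑ j, algebraMap ℝ _ (((A⁻¹ : GL (Fin n) ℝ) : Matrix (Fin n) (Fin n) ℝ) j i) *
        totalDeriv j (pull k A f) := by
  have hpoly : ∀ P : JetPoly n, pull k A (totalDeriv i (toRat n k P)) =
      ∑ j, algebraMap ℝ _ (((A⁻¹ : GL (Fin n) ℝ) : Matrix (Fin n) (Fin n) ℝ) j i) *
        totalDeriv j (pull k A (toRat n k P)) := by
    intro P
    rw [totalDeriv_toRat, pull_toRat, pullPoly_totalDerivPoly, map_sum]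
    refine Finset.sum_congr rfl fun j _ => ?_
    rw [map_smul, pull_toRat, totalDeriv_toRat, Algebra.smul_def]
  -- Both sides obey the product rule over `pull k A`, so that the quotient follows.
  obtain ⟨P, Q, hQ, e⟩ := exists_toRat_div f
  have h1 := hpoly P
  rw [← e] at h1
  simp only [Derivation.leibniz, map_add, smul_eq_mul, map_mul, hpoly Q, mul_add,
    Finset.sum_add_distrib] at h1
  have h0 : pull k A (toRat n k Q) ≠ 0 := by
    rwa [Ne, map_eq_zero]
  have h2 : pull k A f * ∑ j,
      algebraMap ℝ _ (((A⁻¹ : GL (Fin n) ℝ) : Matrix (Fin n) (Fin n) ℝ) j i) *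
        totalDeriv j (pull k A (toRat n k Q)) =
      ∑ j, algebraMap ℝ _ (((A⁻¹ : GL (Fin n) ℝ) : Matrix (Fin n) (Fin n) ℝ) j i) *
        (pull k A f * totalDeriv j (pull k A (toRat n k Q))) := by
    rw [Finset.mul_sum]
    exact Finset.sum_congr rfl fun j _ => by ring
  rw [h2, add_right_inj] at h1
  refine mul_left_cancel₀ h0 (h1.trans ?_)
  rw [Finset.mul_sum]
  exact Finset.sum_congr rfl fun j _ => by ring

end Pull

/-! ### Generation by the coefficients of the tensors -/

section NormalForm

variable {n k : ℕ}

/-- The jet `θ` expressed in its own frame: at a regular jet this is the representative of the orbit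
of `θ` at which `e_1, …, e_n` is the standard basis. -/
def normalJet {K : Type*} [Field K] (θ : Jet K n) : Jet K n :=
  Sum.elim (fun i => if i.val + 1 = n then 1 else 0)
    fun α => applyOp θ (∏ i, dirOp (frame θ i) ^ α i)

/-- The linear map with the frame at a regular jet as its columns. -/
def frameGL {θ : Jet ℝ n} (h : LinearIndependent ℝ (frame θ)) : GL (Fin n) ℝ :=
  Matrix.GeneralLinearGroup.mkOfDetNeZero (Matrix.of (frame θ)).transpose
    (by rw [Matrix.det_transpose]; exact (linearIndependent_iff_det _).mp h)

lemma frameGL_apply {θ : Jet ℝ n} (h : LinearIndependent ℝ (frame θ)) (i j : Fin n) :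
    (frameGL h : Matrix (Fin n) (Fin n) ℝ) i j = frame θ j i := rfl

lemma normalJet_eq_act {θ : Jet ℝ n} (h : LinearIndependent ℝ (frame θ)) :
    normalJet θ = act (frameGL h)⁻¹ θ := by
  funext v
  rcases v with i | α
  · have hpos : 0 < n := i.pos
    have hrad : rad θ = (frameGL h : Matrix (Fin n) (Fin n) ℝ).mulVec
        (Pi.single ⟨n - 1, by omega⟩ 1) := by
      ext j
      rw [Matrix.mulVec_single_one, Matrix.col_apply, frameGL_apply, frame_last θ (by simp; omega)]
      rfl
    rw [act_inl, hrad, inv_mulVec_mulVec, Pi.single_apply]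
    simp only [normalJet, Sum.elim_inl, Fin.ext_iff]
    congr 1
    simp only [eq_iff_iff]
    omega
  · simp only [normalJet, act, Sum.elim_inr, inv_inv]
    rfl

/-- By the Euler equation, operators in the radial direction act on homogeneous operators by
scalars. -/
lemma applyOp_rad_pow_mul_mem {K : Type*} [Field K] {θ : Jet K n} (hθ : IsEulerJet k θ)
    (L : Subfield K) {q : MvPolynomial (Fin n) K} {d : ℕ} (hq : q.IsHomogeneous d)
    (hL : applyOp θ q ∈ L) (m : ℕ) : applyOp θ (dirOp (rad θ) ^ m * q) ∈ L := by
  induction m with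
  | zero => simpa using hL
  | succ m ih =>
    have hhom : (dirOp (rad θ) ^ m * q).IsHomogeneous (m + d) := by
      have := ((isHomogeneous_dirOp (rad θ)).pow m).mul hq
      rwa [one_mul] at this
    rw [pow_succ', mul_assoc]
    by_cases h : m + d < k
    · rw [hθ.applyOp_dirOp_rad_mul hhom h]
      exact mul_mem (sub_mem (natCast_mem _ _) (natCast_mem _ _)) ih
    · rw [hθ.applyOp_eq_zero ((isHomogeneous_dirOp _).mul hhom) (by omega)]
      exact zero_mem _

lemma exists_prod_fin {M ι : Type*} [CommMonoid M] (g : ι → M) {q : M}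
    (hq : q ∈ Submonoid.closure (Set.range g)) :
    ∃ (l : ℕ) (b : Fin l → ι), q = ∏ j, g (b j) := by
  induction hq using Submonoid.closure_induction with
  | mem x hx =>
    obtain ⟨i, rfl⟩ := hx
    exact ⟨1, fun _ => i, by simp⟩
  | one => exact ⟨0, Fin.elim0, by simp⟩
  | mul x y _ _ hx hy =>
    obtain ⟨l, b, rfl⟩ := hx
    obtain ⟨m, c, rfl⟩ := hy
    exact ⟨l + m, Fin.append b c, by simp [Fin.prod_univ_add]⟩

variable [NeZero n]

/-- Products of more than `k` derivatives annihilate `u`, a single derivative along `ker Θ₁` does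
too, and the other products are multiples of `u` and of the coefficients of the `Θ_l⁰`. -/
lemma applyOp_prod_kerFrame_mem (l : ℕ) (b : Fin l → Fin (n - 1)) :
    applyOp (genericJet n k)
      (∏ j, dirOp (kerFrame (genericJet n k) (b j).val : Fin n → RatFun n k)) ∈
      IntermediateField.adjoin ℝ (formInvariants n k) := by
  by_cases hl : k < l
  · have hhom : (∏ j, dirOp (kerFrame (genericJet n k) (b j).val :
        Fin n → RatFun n k)).IsHomogeneous (∑ _j : Fin l, 1) :=
      IsHomogeneous.prod _ _ _ fun j _ => isHomogeneous_dirOp _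
    rw [isEulerJet_genericJet.applyOp_eq_zero hhom (by simpa using hl)]
    exact zero_mem _
  · match l, b, hl with
    | 0, b, _ =>
      rw [Fin.prod_univ_zero, applyOp_one]
      exact IntermediateField.subset_adjoin _ _ (Or.inl rfl)
    | 1, b, _ =>
      rw [Fin.prod_univ_one, mem_kerTheta1.mp (kerFrame (genericJet n k) (b 0).val).2]
      exact zero_mem _
    | l + 2, b, hl =>
      have h : thetaCoeff (genericJet n k) (l + 2) b ∈
          IntermediateField.adjoin ℝ (formInvariants n k) :=
        IntermediateField.subset_adjoin _ _ (Or.inr ⟨l + 2, by omega, by omega, b, rfl⟩)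
      have h2 := mul_mem (natCast_mem _ (l + 2).factorial) h
      rwa [thetaCoeff, theta, mul_inv_cancel_left₀
        (Nat.cast_ne_zero.mpr (Nat.factorial_ne_zero _))] at h2

lemma normalJet_mem (v : Coord n) :
    normalJet (genericJet n k) v ∈ IntermediateField.adjoin ℝ (formInvariants n k) := by
  rcases v with i | α
  · simp only [normalJet, Sum.elim_inl]
    split_ifs
    exacts [one_mem _, zero_mem _]
  · -- Separate the radial factors from those along `ker Θ₁`.
    have hpos := Nat.pos_of_ne_zero (NeZero.ne n)
    let ℓ : Fin n := ⟨n - 1, by omega⟩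
    have hℓ : ℓ.val + 1 = n := by simp only [ℓ]; omega
    obtain ⟨l, b, hb⟩ := exists_prod_fin (fun a : Fin (n - 1) =>
        dirOp (kerFrame (genericJet n k) a.val : Fin n → RatFun n k))
      (q := ∏ i ∈ Finset.univ.erase ℓ, dirOp (frame (genericJet n k) i) ^ α i) (by
        refine prod_mem fun i hi => pow_mem (Submonoid.subset_closure ?_) _
        have hne : i.val ≠ n - 1 := fun h => Finset.ne_of_mem_erase hi (Fin.ext h)
        have := i.2
        exact ⟨⟨i.val, by omega⟩, by rw [frame_of_lt _ (by omega)]⟩)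
    simp only [normalJet, Sum.elim_inr]
    rw [← Finset.mul_prod_erase _ _ (Finset.mem_univ ℓ), hb, frame_last _ hℓ]
    exact applyOp_rad_pow_mul_mem isEulerJet_genericJet
      (IntermediateField.adjoin ℝ (formInvariants n k)).toSubfield
      (IsHomogeneous.prod _ _ _ fun j _ => isHomogeneous_dirOp _)
      (applyOp_prod_kerFrame_mem l b) _

lemma ratOn_normalJet (hk : 3 ≤ k) (v : Coord n) :
    RatOn (regularDomain n k) (normalJet (genericJet n k) v) fun θ => normalJet θ v := by
  rcases v with i | α
  · simp only [normalJet, Sum.elim_inl]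
    split_ifs
    exacts [RatOn.one, RatOn.zero]
  · -- The same list of factors has to serve for the generic jet and for all real jets.
    obtain ⟨l, b, hb⟩ : ∃ (l : ℕ) (b : Fin l → Fin n),
        ∀ (K : Type) [Field K] (Y : Fin n → Fin n → K),
          ∏ i, dirOp (Y i) ^ α i = ∏ j, dirOp (Y (b j)) := by
      obtain ⟨l, b, hb⟩ := exists_prod_fin (fun i : Fin n => (X i : MvPolynomial (Fin n) ℤ))
        (q := ∏ i, X i ^ α i)
        (prod_mem fun i _ => pow_mem (Submonoid.subset_closure (Set.mem_range_self i)) _)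
      refine ⟨l, b, fun K _ Y => ?_⟩
      simpa using congrArg (aeval fun i => dirOp (Y i)) hb
    simp only [normalJet, Sum.elim_inr, hb, applyOp_prod_dirOp]
    exact RatOn.sum _ fun m _ => (RatOn.prod _ fun j _ =>
      (ratOn_frame hk (b j) (m j)).mono regularDomain_subset).mul (RatOn.coord _)

lemma ratOn_aeval {D : Set (Jet ℝ n)} {N : Coord n → RatFun n k} {ν : Jet ℝ n → Jet ℝ n}
    (h : ∀ v, RatOn D (N v) fun θ => ν θ v) (P : JetPoly n) :
    RatOn D (aeval N P) fun θ => eval (ν θ) P := by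
  induction P using MvPolynomial.induction_on with
  | C a => simpa using RatOn.const a
  | add p q hp hq => simpa using hp.add hq
  | mul_X p v hp => simpa using hp.mul (h v)

lemma aeval_mem {N : Coord n → RatFun n k} {L : IntermediateField ℝ (RatFun n k)}
    (h : ∀ v, N v ∈ L) (P : JetPoly n) : aeval N P ∈ L := by
  induction P using MvPolynomial.induction_on with
  | C a => simp
  | add p q hp hq => simpa using add_mem hp hq
  | mul_X p v hp => simpa using mul_mem hp (h v)

/-- The value of an invariant at a regular jet is its value at the normalized jet of the same
orbit, whose coordinates are polynomials in `u` and the coefficients of the `Θ_l⁰`. -/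
lemma mem_adjoin_of_isInvariant (hk : 3 ≤ k) {f : RatFun n k} (hf : IsInvariant f) :
    f ∈ IntermediateField.adjoin ℝ (formInvariants n k) := by
  rw [isInvariant_iff_pull] at hf
  obtain ⟨P₀, Q₀, hQ₀, e₀⟩ := exists_toRat_div f
  obtain ⟨θ₀, hθ₀, hne⟩ : ∃ θ ∈ regularDomain n k, eval θ Q₀ ≠ 0 := by
    by_contra! h
    exact hQ₀ (toRat_eq_zero_iff.mpr (regularDomain_dense hk _ h))
  have hind := fun {θ} (hθ : θ ∈ regularDomain n k) => linearIndependent_frame hk hθ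
  -- The denominator `Q₀` may vanish at all normalized jets. Its translate by the frame at `θ₀` does
  -- not, and the translate of the numerator represents the same invariant with it.
  obtain ⟨P, Q, e, hQ⟩ : ∃ P Q : JetPoly n, f * toRat n k Q = toRat n k P ∧
      eval (normalJet θ₀) Q ≠ 0 := by
    refine ⟨pullPoly (frameGL (hind hθ₀)) P₀, pullPoly (frameGL (hind hθ₀)) Q₀, ?_, ?_⟩
    · rw [← pull_toRat, ← pull_toRat, ← e₀, map_mul, hf]
    · rwa [eval_pullPoly, normalJet_eq_act (hind hθ₀), ← act_mul, mul_inv_cancel, act_one]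
  have hN := ratOn_aeval (ratOn_normalJet (n := n) hk)
  have hQN : aeval (normalJet (genericJet n k)) Q ≠ 0 :=
    (hN Q).ne_zero (fun _ h => h.1) hθ₀ hQ
  have key : toRat n k P * aeval (normalJet (genericJet n k)) Q =
      aeval (normalJet (genericJet n k)) P * toRat n k Q := by
    refine ((RatOn.toRat P).mul (hN Q)).unique_of_regular hk
      (((hN P).mul (RatOn.toRat Q)).congr fun θ hθ => ?_)
    have h1 : toRat n k (P * pullPoly (frameGL (hind hθ))⁻¹ Q) =
        toRat n k (pullPoly (frameGL (hind hθ))⁻¹ P * Q) := by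
      rw [map_mul, map_mul, ← pull_toRat, ← pull_toRat, ← e, map_mul, hf]
      ring
    have h2 := toRat_eq_iff.mp h1 θ hθ.1
    rwa [map_mul, map_mul, eval_pullPoly, eval_pullPoly, ← normalJet_eq_act] at h2
  have hQ0 : toRat n k Q ≠ 0 := by
    intro h0
    have h1 := Aux.mem_eulerIdeal_iff.mp (toRat_eq_zero_iff.mp h0) (normalJet θ₀)
    rw [normalJet_eq_act (hind hθ₀)] at h1 hQ
    exact hQ (h1 (act_mem_eulerEq _ hθ₀.1))
  have hval : f = aeval (normalJet (genericJet n k)) P / aeval (normalJet (genericJet n k)) Q := by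
    rw [eq_div_iff hQN]
    refine mul_right_cancel₀ hQ0 ?_
    rw [← key, ← e]
    ring
  rw [hval]
  exact div_mem (aeval_mem normalJet_mem P) (aeval_mem normalJet_mem Q)

lemma invariantField_eq_adjoin (hk : 3 ≤ k) :
    invariantField n k = IntermediateField.adjoin ℝ (formInvariants n k) := by
  refine le_antisymm (fun f hf => mem_adjoin_of_isInvariant hk hf) ?_
  rw [IntermediateField.adjoin_le_iff]
  rintro f (rfl | ⟨l, -, -, a, rfl⟩)
  exacts [u_mem_invariantField hk, thetaCoeff_mem_invariantField hk l a]

end NormalForm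

/-! ### Generation by Tresse derivatives -/

section Coefficientwise

variable {σ F : Type*} [Field F] [Algebra ℝ F]

/-- A derivation of the coefficients, extended to polynomials with the variables as constants. -/
def coeffDeriv (D : Derivation ℝ F F) (p : MvPolynomial σ F) : MvPolynomial σ F :=
  ∑ α ∈ p.support, monomial α (D (p.coeff α))

lemma coeff_coeffDeriv (D : Derivation ℝ F F) (p : MvPolynomial σ F) (α : σ →₀ ℕ) :
    (coeffDeriv D p).coeff α = D (p.coeff α) := by
  classical
  simp only [coeffDeriv, coeff_sum, coeff_monomial, Finset.sum_ite_eq', mem_support_iff]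
  split_ifs with h
  · rfl
  · rw [not_not.mp h, map_zero]

lemma coeffDeriv_add (D : Derivation ℝ F F) (p q : MvPolynomial σ F) :
    coeffDeriv D (p + q) = coeffDeriv D p + coeffDeriv D q := by
  ext α
  simp only [coeff_coeffDeriv, coeff_add, map_add]

lemma coeffDeriv_zero (D : Derivation ℝ F F) : coeffDeriv D (0 : MvPolynomial σ F) = 0 := by
  simp [coeffDeriv]

lemma coeffDeriv_monomial (D : Derivation ℝ F F) (α : σ →₀ ℕ) (c : F) :
    coeffDeriv D (monomial α c) = monomial α (D c) := by
  classical
  ext β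
  simp only [coeff_coeffDeriv, coeff_monomial]
  split_ifs <;> simp

lemma coeffDeriv_smul (D : Derivation ℝ F F) (c : F) (p : MvPolynomial σ F) :
    coeffDeriv D (c • p) = c • coeffDeriv D p + D c • p := by
  ext α
  simp only [coeff_coeffDeriv, coeff_add, coeff_smul, smul_eq_mul, Derivation.leibniz]
  ring

lemma coeffDeriv_mul (D : Derivation ℝ F F) (p q : MvPolynomial σ F) :
    coeffDeriv D (p * q) = p * coeffDeriv D q + coeffDeriv D p * q := by
  classical
  ext α
  simp only [coeff_coeffDeriv, coeff_add, coeff_mul, map_sum, Derivation.leibniz, smul_eq_mul,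
    ← Finset.sum_add_distrib]
  exact Finset.sum_congr rfl fun x _ => by ring

lemma coeffDeriv_dirOp {n : ℕ} (D : Derivation ℝ F F) (Y : Fin n → F) :
    coeffDeriv D (dirOp Y) = dirOp fun i => D (Y i) := by
  classical
  ext α
  simp only [coeff_coeffDeriv, dirOp_apply, coeff_sum, coeff_smul, smul_eq_mul, coeff_X, map_sum,
    mul_ite, mul_one, mul_zero]
  refine Finset.sum_congr rfl fun i _ => ?_
  split_ifs <;> simp

end Coefficientwise

section Subfields

variable {F : Type*} [Field F] [Algebra ℝ F] (L : IntermediateField ℝ F)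

lemma det_mem {ι : Type*} [Fintype ι] [DecidableEq ι] {M : Matrix ι ι F} (h : ∀ i j, M i j ∈ L) :
    M.det ∈ L := by
  rw [Matrix.det_apply']
  exact sum_mem fun σ _ => mul_mem (intCast_mem _ _) (prod_mem fun i _ => h _ _)

lemma matrix_inv_mem {ι : Type*} [Fintype ι] [DecidableEq ι] {M : Matrix ι ι F}
    (h : ∀ i j, M i j ∈ L) (i j : ι) : M⁻¹ i j ∈ L := by
  rw [Matrix.inv_def, Ring.inverse_eq_inv', Matrix.smul_apply, smul_eq_mul, Matrix.adjugate_apply]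
  refine mul_mem (inv_mem (det_mem L h)) (det_mem L fun a b => ?_)
  rw [Matrix.updateRow_apply, Pi.single_apply]
  split_ifs
  exacts [one_mem _, zero_mem _, h a b]

lemma mulVec_mem {ι : Type*} [Fintype ι] {M : Matrix ι ι F} {v : ι → F}
    (h : ∀ i j, M i j ∈ L) (hv : ∀ i, v i ∈ L) (i : ι) : M.mulVec v i ∈ L :=
  sum_mem fun j _ => mul_mem (h i j) (hv j)

/-- A derivation that maps generators of a field into the field preserves it. -/
lemma derivation_mem_adjoin (D : Derivation ℝ F F) {S : Set F}
    (h : ∀ s ∈ S, D s ∈ IntermediateField.adjoin ℝ S) {f : F}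
    (hf : f ∈ IntermediateField.adjoin ℝ S) : D f ∈ IntermediateField.adjoin ℝ S := by
  induction hf using IntermediateField.adjoin_induction with
  | mem x hx => exact h x hx
  | algebraMap c => rw [D.map_algebraMap]; exact zero_mem _
  | add x y _ _ hx hy => rw [map_add]; exact add_mem hx hy
  | inv x hx hDx =>
    rw [D.leibniz_inv, smul_eq_mul]
    exact mul_mem (neg_mem (pow_mem (inv_mem hx) 2)) hDx
  | mul x y hx hy hDx hDy =>
    rw [D.leibniz, smul_eq_mul, smul_eq_mul]
    exact add_mem (mul_mem hx hDy) (mul_mem hy hDx)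

end Subfields

section Tresse

variable {n k : ℕ} [NeZero n]

/-- The derivation `∑ Y_i d/dx_i` along a horizontal vector field. -/
def alongDeriv (Y : Fin n → RatFun n k) : Derivation ℝ (RatFun n k) (RatFun n k) :=
  ∑ i, Y i • totalDeriv i

lemma alongDeriv_apply (Y : Fin n → RatFun n k) (f : RatFun n k) :
    alongDeriv Y f = ∑ i, Y i * totalDeriv i f := by
  have := congrFun (map_sum Derivation.coeFnAddMonoidHom (fun i => Y i • totalDeriv i)
    Finset.univ) f
  rw [Finset.sum_apply] at this
  exact this

lemma frameDeriv_eq (a : Fin n) (f : RatFun n k) :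
    frameDeriv a f = alongDeriv (frame (genericJet n k) a) f := by
  rw [alongDeriv_apply, frameDeriv]

lemma totalDeriv_genericJet (i : Fin n) (α : Fin n →₀ ℕ) :
    totalDeriv i (genericJet n k (Sum.inr α)) = genericJet n k (Sum.inr (α + oneAt i)) := by
  rw [genericJet, totalDeriv_toRat, totalDerivPoly, mkDerivation_X]
  rfl

/-- The product rule for the derivative along a horizontal vector field of an operator applied to
`u`, the operator having rational functions as coefficients. -/
lemma alongDeriv_applyOp (Y : Fin n → RatFun n k) (p : MvPolynomial (Fin n) (RatFun n k)) :
    alongDeriv Y (applyOp (genericJet n k) p) =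
      applyOp (genericJet n k) (dirOp Y * p) +
        applyOp (genericJet n k) (coeffDeriv (alongDeriv Y) p) := by
  induction p using MvPolynomial.induction_on' with
  | monomial α c =>
    rw [applyOp_monomial, Derivation.leibniz, coeffDeriv_monomial, applyOp_monomial, dirOp_apply,
      Finset.sum_mul, map_sum, alongDeriv_apply, smul_eq_mul, smul_eq_mul, Finset.mul_sum,
      mul_comm (genericJet n k (Sum.inr α))]
    congr 1
    refine Finset.sum_congr rfl fun i _ => ?_
    rw [smul_mul_assoc, map_smul, applyOp_monomial_X_mul, totalDeriv_genericJet, smul_eq_mul]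
    ring
  | add p q hp hq =>
    rw [map_add, map_add, hp, hq, coeffDeriv_add, mul_add, map_add, map_add]
    ring

lemma vecMul_christoffel (hk : 3 ≤ k) (a b : Fin n) :
    Matrix.vecMul (christoffel (k := k) a b) (frameMatrix n k) =
      fun i => frameDeriv a (frame (genericJet n k) b i) := by
  change Matrix.vecMul (Matrix.vecMul _ _) _ = _
  rw [Matrix.vecMul_vecMul, Matrix.nonsing_inv_mul _ (det_frameMatrix_ne_zero hk).isUnit,
    Matrix.vecMul_one]

lemma frameDeriv_frame (hk : 3 ≤ k) (a b i : Fin n) :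
    frameDeriv a (frame (genericJet n k) b i) =
      ∑ c, christoffel a b c * frame (genericJet n k) c i :=
  (congrFun (vecMul_christoffel hk a b) i).symm

lemma pull_frameDeriv (hk : 3 ≤ k) (A : GL (Fin n) ℝ) (a : Fin n) (f : RatFun n k) :
    pull k A (frameDeriv a f) = frameDeriv a (pull k A f) := by
  have hA : ∀ j l, ∑ i, algebraMap ℝ (RatFun n k) ((A : Matrix (Fin n) (Fin n) ℝ) i j) *
      algebraMap ℝ (RatFun n k) (((A⁻¹ : GL (Fin n) ℝ) : Matrix (Fin n) (Fin n) ℝ) l i) =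
      if l = j then 1 else 0 := by
    intro j l
    have : ((A⁻¹ * A : GL (Fin n) ℝ) : Matrix (Fin n) (Fin n) ℝ) l j = if l = j then 1 else 0 := by
      rw [inv_mul_cancel, Units.val_one, Matrix.one_apply]
    rw [Units.val_mul, Matrix.mul_apply] at this
    have h2 := congrArg (algebraMap ℝ (RatFun n k)) this
    rw [map_sum, apply_ite (algebraMap ℝ (RatFun n k)), map_one, map_zero] at h2
    rw [← h2]
    exact Finset.sum_congr rfl fun i _ => by rw [map_mul, mul_comm]
  simp only [frameDeriv, map_sum, map_mul, pull_frame hk, pull_totalDeriv]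
  calc _ = ∑ j, ∑ l, (∑ i, algebraMap ℝ (RatFun n k) ((A : Matrix (Fin n) (Fin n) ℝ) i j) *
        algebraMap ℝ (RatFun n k) (((A⁻¹ : GL (Fin n) ℝ) : Matrix (Fin n) (Fin n) ℝ) l i)) *
          (frame (genericJet n k) a j * totalDeriv l (pull k A f)) := by
        simp only [Finset.sum_mul_sum]
        simp only [Finset.sum_mul]
        rw [Finset.sum_comm]
        refine Finset.sum_congr rfl fun j _ => ?_
        rw [Finset.sum_comm]
        exact Finset.sum_congr rfl fun l _ => Finset.sum_congr rfl fun i _ => by ring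
    _ = _ := by
        simp only [hA, ite_mul, one_mul, zero_mul, Finset.sum_ite_eq', Finset.mem_univ, if_true]

lemma frameDeriv_mem_invariantField (hk : 3 ≤ k) (a : Fin n) {f : RatFun n k}
    (hf : f ∈ invariantField n k) : frameDeriv a f ∈ invariantField n k :=
  isInvariant_iff_pull.mpr fun A => by rw [pull_frameDeriv hk, pull_eq_self hf]

lemma christoffel_mem_invariantField (hk : 3 ≤ k) (a b c : Fin n) :
    christoffel a b c ∈ invariantField n k := by
  refine isInvariant_iff_pull.mpr fun A => ?_
  let AF := (algebraMap ℝ (RatFun n k)).mapMatrix (A : Matrix (Fin n) (Fin n) ℝ)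
  have hAF : IsUnit AF := A.isUnit.map (algebraMap ℝ (RatFun n k)).mapMatrix
  have hM : IsUnit (frameMatrix n k) :=
    (Matrix.isUnit_iff_isUnit_det _).mpr (det_frameMatrix_ne_zero hk).isUnit
  -- The symbols are determined by their contraction with the frame, and `A` is invertible.
  suffices h : (fun c => pull k A (christoffel a b c)) = christoffel a b from congrFun h c
  refine Matrix.vecMul_injective_of_isUnit hM (Matrix.mulVec_injective_of_isUnit hAF ?_)
  beta_reduce
  rw [vecMul_christoffel hk]
  funext i
  have h := congrArg (pull k A) (frameDeriv_frame hk a b i)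
  rw [pull_frameDeriv hk, pull_frame hk, frameDeriv_eq, map_sum, map_sum] at h
  simp only [map_mul, pull_frame hk, Derivation.leibniz, Derivation.map_algebraMap,
    smul_eq_mul, mul_zero, add_zero, ← frameDeriv_eq] at h
  refine Eq.trans ?_ h.symm
  simp only [Matrix.mulVec, dotProduct, Matrix.vecMul, Finset.mul_sum]
  rw [Finset.sum_comm]
  refine Finset.sum_congr rfl fun c _ => Finset.sum_congr rfl fun j _ => ?_
  simp only [AF, RingHom.mapMatrix_apply, Matrix.map_apply, frameMatrix, Matrix.of_apply]
  ring

section GeneralPosition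

variable {J : Fin n → RatFun n k}

lemma jacobian_mulVec_tresse (hJ : GeneralPosition J) (f : RatFun n k) :
    (jacobian J).mulVec (fun b => tresse J b f) = fun i => totalDeriv i f := by
  change (jacobian J).mulVec ((jacobian J)⁻¹.mulVec _) = _
  rw [Matrix.mulVec_mulVec, Matrix.mul_nonsing_inv _ (Ne.isUnit hJ), Matrix.one_mulVec]

/-- The derivation along a frame field, in terms of the Tresse derivatives. -/
lemma frameDeriv_eq_sum_tresse (hJ : GeneralPosition J) (a : Fin n) (f : RatFun n k) :
    frameDeriv a f = ∑ b, dataU J a b * tresse J b f := by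
  have h : ∀ i, totalDeriv i f = ∑ b, totalDeriv i (J b) * tresse J b f :=
    fun i => (congrFun (jacobian_mulVec_tresse hJ f) i).symm
  simp only [dataU, frameDeriv, Finset.sum_mul]
  rw [Finset.sum_comm]
  refine Finset.sum_congr rfl fun i _ => ?_
  rw [h i, Finset.mul_sum]
  exact Finset.sum_congr rfl fun b _ => by ring

lemma tresse_eq_alongDeriv (b : Fin n) (f : RatFun n k) :
    tresse J b f = alongDeriv ((jacobian J)⁻¹ b) f := by
  rw [alongDeriv_apply, tresse, Matrix.mulVec, dotProduct]

lemma tresse_self (hJ : GeneralPosition J) (b c : Fin n) :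
    tresse J b (J c) = if b = c then 1 else 0 := by
  rw [← Matrix.one_apply, ← Matrix.nonsing_inv_mul (jacobian J) (Ne.isUnit hJ), Matrix.mul_apply]
  rfl

lemma isUnit_dataU (hk : 3 ≤ k) (hJ : GeneralPosition J) :
    IsUnit (Matrix.of (dataU J)) := by
  have : Matrix.of (dataU J) = frameMatrix n k * jacobian J := by
    ext a b
    rw [Matrix.mul_apply]
    rfl
  rw [this, Matrix.isUnit_iff_isUnit_det, Matrix.det_mul]
  exact (mul_ne_zero (det_frameMatrix_ne_zero hk) hJ).isUnit

/-- By `e_a f = ∑_b e_a(J_b) df/dJ_b`, the Tresse derivatives of an invariant are obtained from its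
derivatives along the frame by the inverse of an invariant matrix. -/
lemma tresse_mem_invariantField (hk : 3 ≤ k) (hinv : ∀ b, J b ∈ invariantField n k)
    (hJ : GeneralPosition J) (b : Fin n) {f : RatFun n k} (hf : f ∈ invariantField n k) :
    tresse J b f ∈ invariantField n k := by
  have hU := (Matrix.isUnit_iff_isUnit_det _).mp (isUnit_dataU hk hJ)
  have h : (fun b => tresse J b f) =
      (Matrix.of (dataU J))⁻¹.mulVec fun a => frameDeriv a f := by
    have h1 : (fun a => frameDeriv a f) =
        (Matrix.of (dataU J)).mulVec fun b => tresse J b f :=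
      funext fun a => frameDeriv_eq_sum_tresse hJ a f
    rw [h1, Matrix.mulVec_mulVec, Matrix.nonsing_inv_mul _ hU, Matrix.one_mulVec]
  rw [show tresse J b f = _ from congrFun h b]
  exact mulVec_mem _ (matrix_inv_mem _ fun a b => frameDeriv_mem_invariantField hk a (hinv b))
    (fun a => frameDeriv_mem_invariantField hk a hf) b

lemma iterTresse_mem_invariantField (hk : 3 ≤ k) (hinv : ∀ b, J b ∈ invariantField n k)
    (hJ : GeneralPosition J) (s : List (Fin n)) {f : RatFun n k} (hf : f ∈ invariantField n k) :
    iterTresse J s f ∈ invariantField n k := by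
  induction s with
  | nil => exact hf
  | cons b s ih => exact tresse_mem_invariantField hk hinv hJ b ih

lemma tresse_mem_adjoin_dataInvariants (hJ : GeneralPosition J) (b : Fin n) {f : RatFun n k}
    (hf : f ∈ IntermediateField.adjoin ℝ (dataInvariants J)) :
    tresse J b f ∈ IntermediateField.adjoin ℝ (dataInvariants J) := by
  rw [tresse_eq_alongDeriv]
  refine derivation_mem_adjoin _ (fun g hg => ?_) hf
  rw [← tresse_eq_alongDeriv]
  rcases hg with ⟨c, rfl⟩ | ⟨s, a, c, rfl⟩ | ⟨s, a, c, d, rfl⟩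
  · rw [tresse_self hJ]
    split_ifs
    exacts [one_mem _, zero_mem _]
  · exact IntermediateField.subset_adjoin _ _ (Or.inr (Or.inl ⟨b :: s, a, c, rfl⟩))
  · exact IntermediateField.subset_adjoin _ _ (Or.inr (Or.inr ⟨b :: s, a, c, d, rfl⟩))

lemma frameDeriv_mem_adjoin_dataInvariants (hJ : GeneralPosition J) (a : Fin n)
    {f : RatFun n k} (hf : f ∈ IntermediateField.adjoin ℝ (dataInvariants J)) :
    frameDeriv a f ∈ IntermediateField.adjoin ℝ (dataInvariants J) := by
  rw [frameDeriv_eq_sum_tresse hJ]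
  exact sum_mem fun b _ => mul_mem
    (IntermediateField.subset_adjoin _ _ (Or.inr (Or.inl ⟨[], a, b, rfl⟩)))
    (tresse_mem_adjoin_dataInvariants hJ b hf)

end GeneralPosition

section Closed

variable (L : IntermediateField ℝ (RatFun n k))

/-- The span of the derivatives along the frame, over a subfield. -/
def frameSpan : Submodule L (MvPolynomial (Fin n) (RatFun n k)) :=
  Submodule.span L (Set.range fun a => dirOp (frame (genericJet n k) a))

variable {L}

/-- The covariant derivatives of the frame fields are combinations of the frame fields with the
Christoffel symbols as coefficients. -/
lemma coeffDeriv_mem_frameSpan_pow (hk : 3 ≤ k) (hL : ∀ a, ∀ f ∈ L, frameDeriv a f ∈ L)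
    (hΓ : ∀ a b c, christoffel a b c ∈ L) (a : Fin n) (d : ℕ)
    {p : MvPolynomial (Fin n) (RatFun n k)} (hp : p ∈ frameSpan L ^ d) :
    coeffDeriv (alongDeriv (frame (genericJet n k) a)) p ∈ frameSpan L ^ d := by
  induction d generalizing p with
  | zero =>
    rw [pow_zero] at hp ⊢
    obtain ⟨c, rfl⟩ := Submodule.mem_one.mp hp
    refine Submodule.mem_one.mpr ⟨⟨_, hL a c c.2⟩, ?_⟩
    have h := coeffDeriv_monomial (alongDeriv (frame (genericJet n k) a)) (0 : Fin n →₀ ℕ)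
      (c : RatFun n k)
    rw [← frameDeriv_eq] at h
    exact h.symm
  | succ d ih =>
    have h1 : ∀ m ∈ frameSpan L,
        coeffDeriv (alongDeriv (frame (genericJet n k) a)) m ∈ frameSpan L := by
      intro m hm
      induction hm using Submodule.span_induction with
      | mem x hx =>
        obtain ⟨b, rfl⟩ := hx
        have : coeffDeriv (alongDeriv (frame (genericJet n k) a))
            (dirOp (frame (genericJet n k) b)) =
            ∑ c, (⟨christoffel a b c, hΓ a b c⟩ : L) • dirOp (frame (genericJet n k) c) := by
          simp only [coeffDeriv_dirOp, ← frameDeriv_eq, frameDeriv_frame hk]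
          have h2 : (fun i => ∑ c, (christoffel a b c : RatFun n k) * frame (genericJet n k) c i) =
              ∑ c, (christoffel a b c : RatFun n k) • frame (genericJet n k) c := by
            ext i
            simp
          rw [h2, map_sum]
          exact Finset.sum_congr rfl fun c _ => map_smul _ _ _
        rw [this]
        exact sum_mem fun c _ => Submodule.smul_mem _ _ (Submodule.subset_span ⟨c, rfl⟩)
      | zero => rw [coeffDeriv_zero]; exact zero_mem _
      | add x y _ _ hx hy => rw [coeffDeriv_add]; exact add_mem hx hy
      | smul c x hx ih =>
        have : coeffDeriv (alongDeriv (frame (genericJet n k) a)) (c • x) =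
            c • coeffDeriv (alongDeriv (frame (genericJet n k) a)) x +
              (⟨_, hL a c c.2⟩ : L) • x := by
          have := coeffDeriv_smul (alongDeriv (frame (genericJet n k) a)) (c : RatFun n k) x
          rw [← frameDeriv_eq] at this
          exact this
        rw [this]
        exact add_mem (Submodule.smul_mem _ _ ih) (Submodule.smul_mem _ _ hx)
    rw [pow_succ'] at hp ⊢
    refine Submodule.mul_induction_on hp (fun m hm q hq => ?_) fun x y hx hy => ?_
    · rw [coeffDeriv_mul]
      exact add_mem (Submodule.mul_mem_mul hm (ih hq)) (Submodule.mul_mem_mul (h1 m hm) hq)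
    · rw [coeffDeriv_add]
      exact add_mem hx hy

/-- A field of rational functions that contains `u` and the Christoffel symbols and is closed under
the derivations along the frame contains the coefficients of all `Θ_l` in the frame, since
`Θ_{l+1}(e_a, …)` is the covariant derivative of `Θ_l` along `e_a` up to a factor. -/
lemma applyOp_mem_of_mem_frameSpan_pow (hk : 3 ≤ k) (hu : genericJet n k (Sum.inr 0) ∈ L)
    (hL : ∀ a, ∀ f ∈ L, frameDeriv a f ∈ L) (hΓ : ∀ a b c, christoffel a b c ∈ L) (d : ℕ)
    {p : MvPolynomial (Fin n) (RatFun n k)} (hp : p ∈ frameSpan L ^ d) :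
    applyOp (genericJet n k) p ∈ L := by
  induction d generalizing p with
  | zero =>
    rw [pow_zero] at hp
    obtain ⟨c, rfl⟩ := Submodule.mem_one.mp hp
    have : applyOp (genericJet n k) (algebraMap L (MvPolynomial (Fin n) (RatFun n k)) c) =
        c * genericJet n k (Sum.inr 0) := applyOp_monomial _ 0 _
    rw [this]
    exact mul_mem c.2 hu
  | succ d ih =>
    rw [pow_succ'] at hp
    refine Submodule.mul_induction_on hp (fun m hm q hq => ?_) fun x y hx hy => ?_
    · induction hm using Submodule.span_induction with
      | mem x hx =>
        obtain ⟨a, rfl⟩ := hx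
        have h := alongDeriv_applyOp (frame (genericJet n k) a) q
        rw [← frameDeriv_eq, ← sub_eq_iff_eq_add] at h
        rw [← h]
        exact sub_mem (hL a _ (ih hq)) (ih (coeffDeriv_mem_frameSpan_pow hk hL hΓ a d hq))
      | zero => rw [zero_mul, map_zero]; exact zero_mem _
      | add x y _ _ hx hy => rw [add_mul, map_add]; exact add_mem hx hy
      | smul c x _ ih =>
        have : applyOp (genericJet n k) (c • x * q) = c * applyOp (genericJet n k) (x * q) := by
          rw [smul_mul_assoc]
          exact (applyOp (genericJet n k)).map_smul (c : RatFun n k) _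
        rw [this]
        exact mul_mem c.2 ih
    · rw [map_add]
      exact add_mem hx hy

lemma prod_mem_pow_card {R A : Type*} [CommSemiring R] [CommSemiring A] [Algebra R A]
    (M : Submodule R A) (l : ℕ) {x : Fin l → A} (h : ∀ j, x j ∈ M) : ∏ j, x j ∈ M ^ l := by
  induction l with
  | zero => simp [Submodule.one_le.mp le_rfl]
  | succ l ih =>
    rw [Fin.prod_univ_succ, pow_succ']
    exact Submodule.mul_mem_mul (h 0) (ih fun j => h j.succ)

lemma thetaCoeff_mem_of_closed (hk : 3 ≤ k) (hu : genericJet n k (Sum.inr 0) ∈ L)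
    (hL : ∀ a, ∀ f ∈ L, frameDeriv a f ∈ L) (hΓ : ∀ a b c, christoffel a b c ∈ L) (l : ℕ)
    (a : Fin l → Fin (n - 1)) : thetaCoeff (genericJet n k) l a ∈ L := by
  refine mul_mem (inv_mem (natCast_mem _ _))
    (applyOp_mem_of_mem_frameSpan_pow hk hu hL hΓ l (prod_mem_pow_card _ l fun j => ?_))
  have := (a j).2
  refine Submodule.subset_span ⟨⟨(a j).val, by omega⟩, ?_⟩
  beta_reduce
  rw [frame_of_lt _ (by simp only; omega)]

end Closed

/-- The field of invariants is generated by `J` and the Tresse derivatives of the matrices of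
derivatives of `J` along the frame and of Christoffel symbols. -/
lemma invariantField_eq_adjoin_dataInvariants (hk : 3 ≤ k) {J : Fin n → RatFun n k}
    (hinv : ∀ b, J b ∈ invariantField n k)
    (hu : ∀ b : Fin n, b.val + 1 = n → J b = genericJet n k (Sum.inr 0))
    (hJ : GeneralPosition J) :
    invariantField n k = IntermediateField.adjoin ℝ (dataInvariants J) := by
  refine le_antisymm ?_ ?_
  · have hu' : genericJet n k (Sum.inr 0) ∈ IntermediateField.adjoin ℝ (dataInvariants J) := by
      have hpos := Nat.pos_of_ne_zero (NeZero.ne n)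
      rw [← hu ⟨n - 1, by omega⟩ (by simp only; omega)]
      exact IntermediateField.subset_adjoin _ _ (Or.inl ⟨_, rfl⟩)
    rw [invariantField_eq_adjoin hk, IntermediateField.adjoin_le_iff]
    rintro f (rfl | ⟨l, -, -, a, rfl⟩)
    · exact hu'
    · exact thetaCoeff_mem_of_closed hk hu'
        (fun a f hf => frameDeriv_mem_adjoin_dataInvariants hJ a hf)
        (fun a b c => IntermediateField.subset_adjoin _ _ (Or.inr (Or.inr ⟨[], a, b, c, rfl⟩))) l a
  · rw [IntermediateField.adjoin_le_iff]
    rintro f (⟨b, rfl⟩ | ⟨s, a, b, rfl⟩ | ⟨s, a, b, c, rfl⟩)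
    · exact hinv b
    · exact iterTresse_mem_invariantField hk hinv hJ s
        (frameDeriv_mem_invariantField hk a (hinv b))
    · exact iterTresse_mem_invariantField hk hinv hJ s
        (christoffel_mem_invariantField hk a b c)

end Tresse

end HomForms

end

open MvPolynomial HomForms in
theorem mainTheorem3 (n k : ℕ) [NeZero n] (hn : 2 ≤ n) (hk : 3 ≤ k) :
    -- the regular domain is dense in the Euler equation
    (∀ P : JetPoly n, (∀ θ ∈ regularDomain n k, eval θ P = 0) → P ∈ eulerIdeal n k) ∧
    -- `e_1, …, e_n` is a frame over the regular domain, and it is invariant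
    (∀ θ ∈ regularDomain n k,
      LinearIndependent ℝ (frame θ) ∧ Submodule.span ℝ (Set.range (frame θ)) = ⊤ ∧
      ∀ A : GL (Fin n) ℝ, act A θ ∈ regularDomain n k ∧
        ∀ a, frame (act A θ) a = (A : Matrix (Fin n) (Fin n) ℝ).mulVec (frame θ a)) ∧
    -- regularity and the frame depend on the 3-jet only
    (∀ θ ∈ eulerEq n k, ∀ θ' ∈ eulerEq n k, (∀ i, θ (Sum.inl i) = θ' (Sum.inl i)) →
      (∀ α : Fin n →₀ ℕ, α.degree ≤ 3 → θ (Sum.inr α) = θ' (Sum.inr α)) →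
      (IsRegularJet θ ↔ IsRegularJet θ') ∧ frame θ = frame θ') ∧
    -- the components of the frame are rational functions without poles on the regular domain
    (∀ a i, ∃ P Q : JetPoly n,
      (∀ θ ∈ regularDomain n k, eval θ Q ≠ 0 ∧ frame θ a i = eval θ P / eval θ Q) ∧
      frame (genericJet n k) a i * toRat n k Q = toRat n k P) ∧
    LinearIndependent (RatFun n k) (frame (genericJet n k)) ∧
    -- `u` and the coefficients of `Θ_l⁰`, `2 ≤ l ≤ k`, are invariant
    (∀ θ ∈ regularDomain n k, ∀ A : GL (Fin n) ℝ,
      act A θ (Sum.inr 0) = θ (Sum.inr 0) ∧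
      ∀ l, 2 ≤ l → l ≤ k → ∀ a : Fin l → Fin (n - 1),
        thetaCoeff (act A θ) l a = thetaCoeff θ l a) ∧
    -- the coefficients are rational functions without poles on the regular domain
    (∀ l, 2 ≤ l → l ≤ k → ∀ a : Fin l → Fin (n - 1), ∃ P Q : JetPoly n,
      (∀ θ ∈ regularDomain n k, eval θ Q ≠ 0 ∧ thetaCoeff θ l a = eval θ P / eval θ Q) ∧
      thetaCoeff (genericJet n k) l a * toRat n k Q = toRat n k P) ∧
    -- they generate the field of all rational differential invariants
    {f : RatFun n k | IsInvariant f} = IntermediateField.adjoin ℝ (formInvariants n k) ∧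
    -- the same field is generated by `J` and the Tresse derivatives of `U` and `Γ`
    (∀ J : Fin n → RatFun n k, (∀ b, IsInvariant (J b)) →
      (∀ b : Fin n, b.val + 1 = n → J b = genericJet n k (Sum.inr 0)) → GeneralPosition J →
      {f : RatFun n k | IsInvariant f} = IntermediateField.adjoin ℝ (dataInvariants J)) := by
  have hreg := fun θ (hθ : θ ∈ regularDomain n k) => linearIndependent_frame hk hθ
  refine ⟨regularDomain_dense hk, fun θ hθ => ⟨hreg θ hθ, ?_, fun A =>
    ⟨act_mem_regularDomain A hθ, frame_act A θ⟩⟩, fun θ _ θ' _ hx h =>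
    ⟨(Carries.of_eq h).isRegularJet_iff.symm, frame_eq_of_eq hx h⟩,
    fun a i => (ratOn_frame hk a i).mono regularDomain_subset,
    (linearIndependent_iff_det _).mpr (det_frameMatrix_ne_zero hk),
    fun θ _ A => ⟨(carries_act A θ).map_zero, fun l _ _ a => thetaCoeff_act A θ l a⟩,
    fun l _ _ a => (ratOn_thetaCoeff hk l a).mono regularDomain_subset,
    congrArg (fun L : IntermediateField ℝ (RatFun n k) => (L : Set (RatFun n k)))
      (invariantField_eq_adjoin hk),
    fun J hinv hu hJ => congrArg
      (fun L : IntermediateField ℝ (RatFun n k) => (L : Set (RatFun n k)))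
      (invariantField_eq_adjoin_dataInvariants hk hinv hu hJ)⟩
  exact (hreg θ hθ).span_eq_top_of_card_eq_finrank' (by simp)
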